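/- Let $d,D,n$ be positive integers with $dD\ge 2$, and fix a unit vector $|0\rangle\in\mathbb C^d$. For unitaries $U^{(1)},\dots,U^{(n)}\in U(dD)$ acting on $\mathbb C^d\otimes\mathbb C^D$ put $A^{(k)}_i=(\langle i|\otimes \mathbb 1)\,U^{(k)}\,(|0\rangle\otimes\mathbb 1)$ (a $D\times D$ matrix for each $i=1,\dots,d$), and $$|\psi\rangle=\sum_{i_1,\dots,i_n}\operatorname{tr}\bigl[A^{(1)}_{i_1}\cdots A^{(n)}_{i_n}\bigr]\,|i_1,\dots,i_n\rangle\in(\mathbb C^d)^{\otimes n}.$$ Let $\mu_{d,n,D}$ be the law of the random matrix product state $|\psi\rangle$ when $U^{(1)},\dots,U^{(n)}$ are drawn i.i.d. from the Haar probability measure on $U(dD)$, and let $|\psi'\rangle=|\psi\rangle/\sqrt{\langle\psi|\psi\rangle}$ (for $\psi\neq0$). For Hermitian operators $H$ (the Hamiltonian) and $A$ (the observable) on $(\mathbb C^d)^{\otimes n}$ and a vector $\phi$, let $A(t)=e^{iHt}Ae^{-iHt}$, $$A^\infty_\phi=\lim_{t\to\infty}\frac1t\int_0^t\langle\phi|A(s)|\phi\rangle\,ds,\qquad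 \Delta A^\infty_\phi=\lim_{t\to\infty}\frac1t\int_0^t\bigl|\langle\phi|A(s)|\phi\rangle-A^\infty_\phi\bigr|^2ds .$$ Set $$\alpha(d,D)=\log\left(\frac{d-\frac1{dD^2}}{\left(1+\frac1D\right)\left(1+\frac1{dD}\right)}\right).$$ Then there are absolute constants $c_1,c_2>0$ such that for every $K$ there is an $n_0=n_0(K)$ with the following property. For all $d,D$ as above, all $n\ge n_0$, every choice of $|0\rangle$, every Hamiltonian $H$ with non-degenerate spectrum (its eigenvalues $E_a$, listed with multiplicity, are pairwise distinct) and non-degenerate gaps ($E_a-E_b=E_{a'}-E_{b'}$ with $a\ne b$ implies $a=a'$ and $b=b'$), and every observable $A$ with operator norm $\|A\|\le K$, $$\Pr_{\psi\sim\mu_{d,n,D}}\Bigl(\psi\ne 0,\ \text{the limits defining } \Delta A^\infty_{\psi'} \text{ exist, and } \Delta A^\infty_{\psi'}\le e^{-c_1\alpha(d,D)n}\Bigr)\ \ge\ 1-e^{-c_2\alpha(d,D)n}.$$ -/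

import Mathlib

open MeasureTheory Filter Topology

noncomputable section

namespace RMPS

/-! ### Haar measure on the unitary group of one site -/

/-- The unitary group `U(dD)`, acting on `ℂ^d ⊗ ℂ^D` with product basis indexed by
`Fin d × Fin D`. -/
abbrev SiteUnitary (d D : ℕ) : Type := Matrix.unitaryGroup (Fin d × Fin D) ℂ

instance instMeasurableSpaceSiteUnitary (d D : ℕ) : MeasurableSpace (SiteUnitary d D) :=
  borel _

instance instBorelSpaceSiteUnitary (d D : ℕ) : BorelSpace (SiteUnitary d D) := ⟨rfl⟩

instance instSecondCountableTopologySiteUnitary (d D : ℕ) :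
    SecondCountableTopology (SiteUnitary d D) :=
  haveI : SecondCountableTopology (Matrix (Fin d × Fin D) (Fin d × Fin D) ℂ) :=
    inferInstanceAs (SecondCountableTopology (Fin d × Fin D → Fin d × Fin D → ℂ))
  Topology.IsInducing.subtypeVal.secondCountableTopology

instance instCompactSpaceSiteUnitary (d D : ℕ) : CompactSpace (SiteUnitary d D) := by
  have hc : IsClosed
      (Matrix.unitaryGroup (Fin d × Fin D) ℂ : Set (Matrix (Fin d × Fin D) (Fin d × Fin D) ℂ)) := by
    have : (Matrix.unitaryGroup (Fin d × Fin D) ℂ :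
        Set (Matrix (Fin d × Fin D) (Fin d × Fin D) ℂ)) = {U | U * star U = 1} := by
      ext U
      exact Matrix.mem_unitaryGroup_iff
    rw [this]
    exact isClosed_eq (by fun_prop) continuous_const
  have hk : IsCompact (Set.univ.pi fun _ => Set.univ.pi fun _ => Metric.closedBall (0 : ℂ) 1 :
      Set (Fin d × Fin D → Fin d × Fin D → ℂ)) :=
    isCompact_univ_pi fun _ => isCompact_univ_pi fun _ => isCompact_closedBall _ _
  refine isCompact_iff_compactSpace.mp (IsCompact.of_isClosed_subset hk hc ?_)
  intro U hU i _ j _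
  simpa using entry_norm_bound_of_unitary hU i j

/-- The Haar probability measure on `U(dD)`: total mass one on the whole (compact) group. -/
def haarUnitary (d D : ℕ) : Measure (SiteUnitary d D) := Measure.haarMeasure ⊤

instance instIsProbabilityMeasureHaarUnitary (d D : ℕ) :
    IsProbabilityMeasure (haarUnitary d D) :=
  ⟨by simpa [haarUnitary] using Measure.haarMeasure_self (K₀ := (⊤ : TopologicalSpace.PositiveCompacts
    (SiteUnitary d D)))⟩

/-! ### Random matrix product states -/

/-- State vectors of `n` qudits of local dimension `d`: the Hilbert space `(ℂ^d)^{⊗ n}`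
in its product basis `|i_1, …, i_n⟩`. -/
abbrev StateSpace (n d : ℕ) : Type := EuclideanSpace ℂ (Fin n → Fin d)

/-- The MPS tensor obtained from a unitary `U` on `ℂ^d ⊗ ℂ^D` by feeding the vector `v` into the
`ℂ^d` input: `A_i = (⟨i| ⊗ 1) U (|v⟩ ⊗ 1)`, a `D × D` matrix for each `i`. -/
def siteTensor {d D : ℕ} (v : EuclideanSpace ℂ (Fin d)) (U : SiteUnitary d D) (i : Fin d) :
    Matrix (Fin D) (Fin D) ℂ :=
  Matrix.of fun a b => ∑ j, (U : Matrix (Fin d × Fin D) (Fin d × Fin D) ℂ) (i, a) (j, b) * v j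

/-- The (in general not normalized) matrix product state with periodic boundary conditions
`∑ tr(A^{(1)}_{i_1} ⋯ A^{(n)}_{i_n}) |i_1, …, i_n⟩` built from the unitaries
`U^{(1)}, …, U^{(n)}`. -/
def mps {n d D : ℕ} (v : EuclideanSpace ℂ (Fin d)) (U : Fin n → SiteUnitary d D) :
    StateSpace n d :=
  WithLp.toLp 2 fun i => (List.ofFn fun k => siteTensor v (U k) (i k)).prod.trace

theorem continuous_mps {n d D : ℕ} (v : EuclideanSpace ℂ (Fin d)) :
    Continuous (mps v : (Fin n → SiteUnitary d D) → StateSpace n d) := by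
  have hs : ∀ i : Fin d, Continuous fun U : SiteUnitary d D => siteTensor v U i := by
    intro i
    refine continuous_matrix fun a b => ?_
    simp only [siteTensor, Matrix.of_apply]
    refine continuous_finsetSum _ fun j _ => ?_
    exact (continuous_subtype_val.matrix_elem _ _).mul continuous_const
  refine (PiLp.continuous_toLp 2 _).comp (continuous_pi fun i => Continuous.matrix_trace ?_)
  simp only [List.ofFn_eq_map]
  exact continuous_list_prod _ fun k _ => (hs (i k)).comp (continuous_apply k)

theorem measurable_mps {n d D : ℕ} (v : EuclideanSpace ℂ (Fin d)) :
    Measurable (mps v : (Fin n → SiteUnitary d D) → StateSpace n d) :=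
  (continuous_mps v).measurable

/-- The law `μ_{d,n,D}` of the random matrix product state: the unitaries
`U^{(1)}, …, U^{(n)}` are drawn i.i.d. from the Haar measure on `U(dD)`. -/
def rmpsMeasure (d n D : ℕ) (v : EuclideanSpace ℂ (Fin d)) : Measure (StateSpace n d) :=
  (Measure.pi fun _ : Fin n => haarUnitary d D).map (mps v)

instance instIsProbabilityMeasureRmpsMeasure (d n D : ℕ) (v : EuclideanSpace ℂ (Fin d)) :
    IsProbabilityMeasure (rmpsMeasure d n D v) :=
  Measure.isProbabilityMeasure_map (measurable_mps v).aemeasurable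

/-- The normalized vector `ψ' = ψ / √⟨ψ|ψ⟩`. -/
def normalized {n d : ℕ} (ψ : StateSpace n d) : StateSpace n d := ((‖ψ‖⁻¹ : ℝ) : ℂ) • ψ

/-! ### Time evolution and equilibration -/

/-- Operators on `(ℂ^d)^{⊗ n}` in the product basis. -/
abbrev Operator (n d : ℕ) : Type := Matrix (Fin n → Fin d) (Fin n → Fin d) ℂ

/-- The spectrum of the Hamiltonian `H` is non-degenerate: eigenvalues, listed with multiplicity,
are pairwise distinct. -/
def NondegenerateSpectrum {n d : ℕ} {H : Operator n d} (hH : H.IsHermitian) : Prop :=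
  Function.Injective hH.eigenvalues

/-- The spectral gaps of `H` are non-degenerate: a nontrivial gap `E_a - E_b`, `a ≠ b`, determines
the ordered pair of levels `(a, b)`. -/
def NondegenerateGaps {n d : ℕ} {H : Operator n d} (hH : H.IsHermitian) : Prop :=
  ∀ a b a' b', a ≠ b →
    hH.eigenvalues a - hH.eigenvalues b = hH.eigenvalues a' - hH.eigenvalues b' →
      a = a' ∧ b = b'

/-- The Heisenberg-evolved observable `A(t) = e^{iHt} A e^{-iHt}`. -/
def evolved {n d : ℕ} (H A : Operator n d) (t : ℝ) : Operator n d :=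
  NormedSpace.exp ((Complex.I * t) • H) * A * NormedSpace.exp (-((Complex.I * t) • H))

/-- The expectation value `⟨ψ|A(t)|ψ⟩`. -/
def expectation {n d : ℕ} (H A : Operator n d) (ψ : StateSpace n d) (t : ℝ) : ℂ :=
  inner ℂ ψ (Matrix.toEuclideanCLM (𝕜 := ℂ) (evolved H A t) ψ)

/-- `a` is the infinite-time average `lim_{t → ∞} (1/t) ∫_0^t f(s) ds`. -/
def IsTimeAverage {E : Type*} [NormedAddCommGroup E] [NormedSpace ℝ E] (f : ℝ → E) (a : E) :
    Prop :=
  Tendsto (fun t : ℝ => t⁻¹ • ∫ s in (0 : ℝ)..t, f s) atTop (𝓝 a)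

/-- `δ` is the fluctuation `ΔA^∞_ψ` of `⟨ψ|A(t)|ψ⟩` around its infinite-time average `A^∞_ψ`;
both limits are required to exist. -/
def IsFluctuation {n d : ℕ} (H A : Operator n d) (ψ : StateSpace n d) (δ : ℝ) : Prop :=
  ∃ a : ℂ, IsTimeAverage (expectation H A ψ) a ∧
    IsTimeAverage (fun t => ‖expectation H A ψ t - a‖ ^ 2) δ

/-- The rate `α(d,D) = log ((d - 1/(dD²)) / ((1 + 1/D)(1 + 1/(dD))))`. -/
def alpha (d D : ℕ) : ℝ :=
  Real.log (((d : ℝ) - 1 / (d * (D : ℝ) ^ 2)) /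
    ((1 + 1 / (D : ℝ)) * (1 + 1 / ((d : ℝ) * D))))

end RMPS

end

/-!
# Equilibration of random matrix product states

The fluctuation of an observable `A` around its time average in a state `φ` is at most
`‖A‖² ∑_a |⟨e_a|φ⟩|⁴`, where `e_a` is the eigenbasis of the Hamiltonian
(`exists_isFluctuation_le`): expanded in the eigenbasis, the expectation value is a trigonometric
polynomial whose frequencies are the gaps, and non-degeneracy of the gaps allows Parseval's identity
to be applied. It remains to show that a random matrix product state is typically spread over every
fixed orthonormal basis.

The average of two copies of a Haar random unitary and two copies of its conjugate is supported on
the identity and the swap (`haar_second_moment`), since those span the commutant of all `g ⊗ g`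
(`commutant_entry`). The sites being independent, the average of `ψ ⊗ ψ ⊗ ψ̄ ⊗ ψ̄` becomes a sum over
configurations `σ : Fin n → {1, swap}` on a ring with nearest-neighbour weights
(`integral_mps_quad`), that is, the trace of the `n`-th power of a `2 × 2` matrix:

* for the overlap with a unit vector `e`, each configuration is weighted by a number of modulus at
  most one, the purity of a subsystem in the state `e`; this gives
  `E |⟨e|ψ⟩|⁴ ≤ 2 ((D + 1) / (d (dD + 1)))ⁿ` (`integral_overlap_pow_four_le`), and summation over the
  `dⁿ` vectors of a basis leaves `2 ((D + 1) / (dD + 1))ⁿ`;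
* for the norm, `E ‖ψ‖² = 1` and `E ‖ψ‖⁴ = 1 + λⁿ` with `λ = d (D² - 1) / (d²D² - 1)`
  (`integral_norm_sq_mps`, `integral_norm_pow_four_mps`).

Since `α = log ((dD - 1) / (D + 1))` (`alpha_eq_log`), both `((D + 1) / (dD + 1))ⁿ` and `λⁿ` are at
most `exp (-α n)`. The inequalities of Markov and Chebyshev conclude; the constants are absorbed
because a positive `α` is at least `log (5/4)` (`five_fourths_le_of_one_lt`).
-/

noncomputable section

namespace RMPS

open scoped Kronecker

/-! ### The commutant of all `g ⊗ g` -/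

section Commutant

variable {ι : Type*} [Fintype ι] [DecidableEq ι]

/-- First-order consequence of commuting with all `g ⊗ g`. The matrix `1 + z P` is unitary whenever
`1 + z` has modulus one, and two such values of `z` separate the terms of first and second order
in `z`. -/
lemma commute_kronecker_sum_of_projection {T : Matrix (ι × ι) (ι × ι) ℂ}
    (hT : ∀ g ∈ Matrix.unitaryGroup ι ℂ, (g ⊗ₖ g) * T = T * (g ⊗ₖ g))
    {P : Matrix ι ι ℂ} (hP : P.IsHermitian) (hPP : P * P = P) :
    (P ⊗ₖ 1 + 1 ⊗ₖ P) * T = T * (P ⊗ₖ (1 : Matrix ι ι ℂ) + (1 : Matrix ι ι ℂ) ⊗ₖ P) := by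
  have key : ∀ z : ℂ, z + star z + z * star z = 0 →
      z • ((P ⊗ₖ 1 + 1 ⊗ₖ P) * T - T * (P ⊗ₖ (1 : Matrix ι ι ℂ) + (1 : Matrix ι ι ℂ) ⊗ₖ P))
        + z ^ 2 • ((P ⊗ₖ P) * T - T * (P ⊗ₖ P)) = 0 := by
    intro z hz
    have hg : 1 + z • P ∈ Matrix.unitaryGroup ι ℂ := by
      rw [Matrix.mem_unitaryGroup_iff, Matrix.star_eq_conjTranspose]
      simp only [Matrix.conjTranspose_add, Matrix.conjTranspose_one, Matrix.conjTranspose_smul,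
        hP.eq, add_mul, mul_add, one_mul, mul_one, Matrix.smul_mul, Matrix.mul_smul, hPP]
      have : (1 : Matrix ι ι ℂ) + z • P + (star z • P + star z • z • P)
          = 1 + (z + star z + z * star z) • P := by
        module
      rw [this, hz, zero_smul, add_zero]
    have := hT _ hg
    have e : (1 + z • P) ⊗ₖ (1 + z • P) = 1 + z • (P ⊗ₖ (1 : Matrix ι ι ℂ)
        + (1 : Matrix ι ι ℂ) ⊗ₖ P) + z ^ 2 • (P ⊗ₖ P) := by
      simp only [Matrix.add_kronecker, Matrix.kronecker_add, Matrix.smul_kronecker,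
        Matrix.kronecker_smul, Matrix.one_kronecker_one]
      module
    rw [e] at this
    simp only [add_mul, mul_add, Matrix.smul_mul, Matrix.mul_smul, one_mul, mul_one] at this ⊢
    rw [← sub_eq_zero] at this
    rw [← this]
    module
  have h1 := key (-2) (by norm_num)
  have h2 := key (Complex.I - 1) (by
    apply Complex.ext <;> simp)
  rw [← sub_eq_zero]
  have hI : (Complex.I - 1) ^ 2 = -2 * Complex.I := by
    linear_combination Complex.I_sq
  rw [hI] at h2
  generalize (P ⊗ₖ 1 + 1 ⊗ₖ P) * T - T * (P ⊗ₖ (1 : Matrix ι ι ℂ) + (1 : Matrix ι ι ℂ) ⊗ₖ P) = X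
    at *
  generalize (P ⊗ₖ P) * T - T * (P ⊗ₖ P) = Y at *
  have : X = -(Complex.I / 2) • ((-2 : ℂ) • X + (-2 : ℂ) ^ 2 • Y)
      - ((Complex.I - 1) • X + (-2 * Complex.I) • Y) := by
    module
  rw [this, h1, h2]; simp

/-- Polarization: every matrix unit `E_xy` with `x ≠ y` is a combination of the rank-one projections
onto the vectors `(e_x + ζ e_y) / √2` with `ζ ∈ {1, -1, i, -i}`. -/
lemma commute_kronecker_sum_single {T : Matrix (ι × ι) (ι × ι) ℂ}
    (hT : ∀ g ∈ Matrix.unitaryGroup ι ℂ, (g ⊗ₖ g) * T = T * (g ⊗ₖ g)) (x y : ι) :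
    (Matrix.single x y (1 : ℂ) ⊗ₖ 1 + 1 ⊗ₖ Matrix.single x y (1 : ℂ)) * T
      = T * (Matrix.single x y (1 : ℂ) ⊗ₖ (1 : Matrix ι ι ℂ)
        + (1 : Matrix ι ι ℂ) ⊗ₖ Matrix.single x y (1 : ℂ)) := by
  by_cases hxy : x = y
  · subst hxy
    exact commute_kronecker_sum_of_projection hT
      (by simp [Matrix.IsHermitian, Matrix.conjTranspose_single]) (by simp)
  let φ : Matrix ι ι ℂ →ₗ[ℂ] Matrix (ι × ι) (ι × ι) ℂ :=
    { toFun := fun E => (E ⊗ₖ 1 + 1 ⊗ₖ E) * T - T * (E ⊗ₖ (1 : Matrix ι ι ℂ)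
        + (1 : Matrix ι ι ℂ) ⊗ₖ E)
      map_add' := fun E E' => by
        simp only [Matrix.add_kronecker, Matrix.kronecker_add, add_mul, mul_add]
        abel
      map_smul' := fun c E => by
        simp only [Matrix.smul_kronecker, Matrix.kronecker_smul, add_mul, mul_add,
          Matrix.smul_mul, Matrix.mul_smul, RingHom.id_apply, smul_sub, smul_add] }
  have key : ∀ ζ : ℂ, ζ * star ζ = 1 → φ ((2⁻¹ : ℂ) • (Matrix.single x x (1 : ℂ)
      + Matrix.single y y (1 : ℂ) + ζ • Matrix.single x y (1 : ℂ)
      + star ζ • Matrix.single y x (1 : ℂ))) = 0 := by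
    intro ζ hζ
    refine sub_eq_zero.mpr (commute_kronecker_sum_of_projection hT ?_ ?_)
    · simp [Matrix.IsHermitian, Matrix.conjTranspose_single]
      module
    · have hyx : y ≠ x := Ne.symm hxy
      simp only [Matrix.smul_mul, Matrix.mul_smul, add_mul, mul_add,
        Matrix.single_mul_single_same, mul_one, Matrix.single_mul_single_of_ne _ _ _ _ hxy,
        Matrix.single_mul_single_of_ne _ _ _ _ hyx, smul_zero, add_zero, zero_add]
      rw [← sub_eq_zero]
      trans (4⁻¹ * (ζ * star ζ - 1)) • (Matrix.single x x (1 : ℂ) + Matrix.single y y (1 : ℂ))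
      · module
      · rw [hζ]; simp
  have h1 := key 1 (by simp)
  have h2 := key (-1) (by simp)
  have h3 := key Complex.I (by simp)
  have h4 := key (-Complex.I) (by simp)
  simp only [map_add, map_smul, star_one, star_neg, Complex.star_def, Complex.conj_I]
    at h1 h2 h3 h4
  refine sub_eq_zero.mp (?_ : φ (Matrix.single x y 1) = 0)
  generalize φ (Matrix.single x x 1) = A, φ (Matrix.single y y 1) = B,
    φ (Matrix.single x y 1) = C, φ (Matrix.single y x 1) = D at *
  have e : C = ((2⁻¹ : ℂ) • ((2⁻¹ : ℂ) • (A + B + (1 : ℂ) • C + (1 : ℂ) • D))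
      - (2⁻¹ : ℂ) • ((2⁻¹ : ℂ) • (A + B + (-1 : ℂ) • C + (-1 : ℂ) • D))
      - (Complex.I / 2) • ((2⁻¹ : ℂ) • (A + B + Complex.I • C + (-Complex.I) • D))
      + (Complex.I / 2) • ((2⁻¹ : ℂ) • (A + B + (-Complex.I) • C + (- -Complex.I) • D)))
      + ((1 + Complex.I * Complex.I) / 2) • (C - D) := by
    module
  rw [h1, h2, h3, h4, Complex.I_mul_I] at e
  simpa using e

/-- The commutation with `E_xy ⊗ 1 + 1 ⊗ E_xy`, entrywise. -/
lemma entry_identity {T : Matrix (ι × ι) (ι × ι) ℂ}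
    (hT : ∀ g ∈ Matrix.unitaryGroup ι ℂ, (g ⊗ₖ g) * T = T * (g ⊗ₖ g)) (a a' b b' x y : ι) :
    (if a = x then T (y, a') (b, b') else 0) + (if a' = x then T (a, y) (b, b') else 0)
     = (if b = y then T (a, a') (x, b') else 0) + (if b' = y then T (a, a') (b, x) else 0) := by
  have h := congrFun (congrFun (commute_kronecker_sum_single hT x y) (a, a')) (b, b')
  simp only [Matrix.mul_apply, Fintype.sum_prod_type, Matrix.add_apply, Matrix.kroneckerMap_apply,
    Matrix.single_apply, Matrix.one_apply, add_mul, mul_add, Finset.sum_add_distrib] at h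
  simpa [ite_and, eq_comm] using h

/-- Elements of the commutant of all `g ⊗ g` are spanned by the identity and the swap; the
coefficients are expressed through the two traces. -/
lemma commutant_entry {T : Matrix (ι × ι) (ι × ι) ℂ}
    (hT : ∀ g ∈ Matrix.unitaryGroup ι ℂ, (g ⊗ₖ g) * T = T * (g ⊗ₖ g)) (a a' b b' : ι) :
    (Fintype.card ι : ℂ) * ((Fintype.card ι : ℂ) ^ 2 - 1) * T (a, a') (b, b') =
      (Fintype.card ι * (∑ x, ∑ y, T (x, y) (x, y)) - ∑ x, ∑ y, T (x, y) (y, x))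
          * (if a = b ∧ a' = b' then 1 else 0)
        + (Fintype.card ι * (∑ x, ∑ y, T (x, y) (y, x)) - ∑ x, ∑ y, T (x, y) (x, y))
          * (if a = b' ∧ a' = b then 1 else 0) := by
  generalize hq : (Fintype.card ι : ℂ) = q
  have hent := entry_identity hT
  -- Both partial traces of `T` turn out to be scalar matrices.
  have hR : ∀ a' b' x y : ι, (if b' = y then ∑ c, T (c, a') (c, x) else 0)
      = if a' = x then ∑ c, T (c, y) (c, b') else 0 := by
    intro a' b' x y
    have := Finset.sum_congr rfl fun (c : ι) (_ : c ∈ Finset.univ) => hent c a' c b' x y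
    simp only [Finset.sum_add_distrib, Finset.sum_ite_eq', Finset.mem_univ, if_true,
      Finset.sum_ite_irrel, Finset.sum_const_zero] at this
    exact (add_left_cancel this).symm
  have hS : ∀ a b' x y : ι, (if b' = y then ∑ c, T (a, c) (c, x) else 0)
      = if a = x then ∑ c, T (y, c) (c, b') else 0 := by
    intro a b' x y
    have := Finset.sum_congr rfl fun (c : ι) (_ : c ∈ Finset.univ) => hent a c c b' x y
    simp only [Finset.sum_add_distrib, Finset.sum_ite_eq', Finset.mem_univ, if_true,
      Finset.sum_ite_irrel, Finset.sum_const_zero] at this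
    linear_combination -this
  -- Summing the identity over `b = y` expresses `T` through its partial traces.
  have hQ : ∀ x b' : ι, q * T (a, a') (x, b') + T (a, a') (b', x)
      = (if a = x then ∑ c, T (c, a') (c, b') else 0)
        + (if a' = x then ∑ c, T (a, c) (c, b') else 0) := by
    intro x b'
    have := Finset.sum_congr rfl fun (c : ι) (_ : c ∈ Finset.univ) => hent a a' c b' x c
    simp only [Finset.sum_add_distrib, Finset.sum_ite_eq, Finset.mem_univ, if_true,
      Finset.sum_ite_irrel, Finset.sum_const_zero, Finset.sum_const, Finset.card_univ,
      nsmul_eq_mul, hq] at this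
    exact this.symm
  have hR' : ∀ a' x : ι, q * ∑ c, T (c, a') (c, x)
      = if a' = x then ∑ c, ∑ c', T (c, c') (c, c') else 0 := by
    intro a' x
    have := Finset.sum_congr rfl fun (c : ι) (_ : c ∈ Finset.univ) => hR a' c x c
    simp only [Finset.sum_ite_irrel, Finset.sum_const_zero, if_true, Finset.sum_const,
      Finset.card_univ, nsmul_eq_mul, hq] at this
    rw [this, Finset.sum_comm]
  have hS' : ∀ a x : ι, q * ∑ c, T (a, c) (c, x)
      = if a = x then ∑ c, ∑ c', T (c, c') (c', c) else 0 := by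
    intro a x
    have := Finset.sum_congr rfl fun (c : ι) (_ : c ∈ Finset.univ) => hS a c x c
    simpa only [Finset.sum_ite_irrel, Finset.sum_const_zero, if_true, Finset.sum_const,
      Finset.card_univ, nsmul_eq_mul, hq] using this
  have e1 := hQ b b'
  have e2 := hQ b' b
  have r1 := hR' a' b'
  have r2 := hR' a' b
  have s1 := hS' a b'
  have s2 := hS' a b
  generalize (∑ c, ∑ c', T (c, c') (c, c')) = t1, (∑ c, ∑ c', T (c, c') (c', c)) = t2 at *
  have : q * (q ^ 2 - 1) * T (a, a') (b, b') =
      q * (q * (q * T (a, a') (b, b') + T (a, a') (b', b)))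
       - q * (q * T (a, a') (b', b) + T (a, a') (b, b')) := by ring
  rw [this, e1, e2]
  simp only [mul_add, mul_ite, mul_zero, r1, r2, s1, s2, ite_and]
  split_ifs <;> ring

end Commutant

/-! ### First and second moments of the Haar measure -/

section HaarMoments

variable {d D : ℕ}

lemma continuous_mulVec_apply (x : Fin d × Fin D → ℂ) (a : Fin d × Fin D) :
    Continuous fun U : SiteUnitary d D => (U.1.mulVec x) a :=
  continuous_finsetSum _ fun _ _ => (continuous_subtype_val.matrix_elem _ _).mul continuous_const

instance instIsMulLeftInvariantHaarUnitary : (haarUnitary d D).IsMulLeftInvariant :=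
  Measure.isMulLeftInvariant_haarMeasure _

lemma integrable_of_continuous_site {f : SiteUnitary d D → ℂ} (hf : Continuous f) :
    Integrable f (haarUnitary d D) :=
  hf.integrable_of_hasCompactSupport (HasCompactSupport.of_compactSpace f)

/-- The operator `(U ⊗ U) |x ⊗ x'⟩⟨z ⊗ z'| (U ⊗ U)ᴴ`, entrywise. -/
def twoCopy (x x' z z' : Fin d × Fin D → ℂ) (U : SiteUnitary d D) :
    Matrix ((Fin d × Fin D) × (Fin d × Fin D)) ((Fin d × Fin D) × (Fin d × Fin D)) ℂ :=
  Matrix.of fun p r => (U.1.mulVec x) p.1 * (U.1.mulVec x') p.2 *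
    star ((U.1.mulVec z) r.1) * star ((U.1.mulVec z') r.2)

lemma continuous_twoCopy (x x' z z' : Fin d × Fin D → ℂ) (p r) :
    Continuous fun U : SiteUnitary d D => twoCopy x x' z z' U p r := by
  simp only [twoCopy, Matrix.of_apply]
  have := fun x => continuous_mulVec_apply (d := d) (D := D) x
  fun_prop

/-- `(G ⊗ G) |X ⊗ X'⟩⟨Z ⊗ Z'| (G ⊗ G)ᴴ` is again of rank one. -/
lemma kronecker_conj_rankOne {ι : Type*} [Fintype ι] (G : Matrix ι ι ℂ) (X X' Z Z' : ι → ℂ)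
    (a a' b b' : ι) :
    ((G ⊗ₖ G) * (Matrix.of fun p r : ι × ι => X p.1 * X' p.2 * star (Z r.1) * star (Z' r.2))
        * (G ⊗ₖ G).conjTranspose) (a, a') (b, b') =
      G.mulVec X a * G.mulVec X' a' * star (G.mulVec Z b) * star (G.mulVec Z' b') := by
  simp only [Matrix.mul_apply, Matrix.conjTranspose_apply, Matrix.of_apply,
    Matrix.kroneckerMap_apply, Fintype.sum_prod_type]
  have inner : ∀ c c', ∑ i, ∑ j, G a i * G a' j * (X i * X' j * star (Z c) * star (Z' c'))
      = G.mulVec X a * G.mulVec X' a' * star (Z c) * star (Z' c') := by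
    intro c c'
    simp only [Matrix.mulVec, dotProduct, Finset.sum_mul_sum]
    simp only [Finset.sum_mul]
    exact Finset.sum_congr rfl fun _ _ => Finset.sum_congr rfl fun _ _ => by ring
  simp only [inner]
  generalize G.mulVec X a * G.mulVec X' a' = Y
  simp only [Matrix.mulVec, dotProduct, star_sum, star_mul', mul_assoc, Finset.sum_mul_sum]
  simp only [Finset.mul_sum]
  exact Finset.sum_congr rfl fun _ _ => Finset.sum_congr rfl fun _ _ => by ring

lemma twoCopy_mul (x x' z z' : Fin d × Fin D → ℂ) (g U : SiteUnitary d D) :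
    twoCopy x x' z z' (g * U) =
      (g.1 ⊗ₖ g.1) * twoCopy x x' z z' U * (g.1 ⊗ₖ g.1).conjTranspose := by
  ext ⟨a, a'⟩ ⟨b, b'⟩
  have e : ∀ y, (g * U).1.mulVec y = g.1.mulVec (U.1.mulVec y) := fun y => by
    simp [Matrix.mulVec_mulVec]
  simp only [twoCopy, kronecker_conj_rankOne]
  simp only [Matrix.of_apply, e]

lemma star_dotProduct_mulVec (U : SiteUnitary d D) (z x : Fin d × Fin D → ℂ) :
    ∑ a, (U.1.mulVec x) a * star ((U.1.mulVec z) a) = star z ⬝ᵥ x := by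
  have h : star (U.1.mulVec z) ⬝ᵥ (U.1.mulVec x) = star z ⬝ᵥ x := by
    rw [Matrix.star_mulVec, ← Matrix.dotProduct_mulVec, Matrix.mulVec_mulVec,
      ← Matrix.star_eq_conjTranspose, Matrix.mem_unitaryGroup_iff'.1 U.2, Matrix.one_mulVec]
  rw [← h]
  simp [dotProduct, mul_comm]

/-- The second moment of the Haar measure of `U(q)`, `q = dD`: the average of
`(U ⊗ U) |x ⊗ x'⟩⟨z ⊗ z'| (U ⊗ U)ᴴ` lies in the commutant of all `g ⊗ g`, and its traces against the
identity and the swap do not depend on `U`. -/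
lemma haar_second_moment (hq : 1 < d * D) (x x' z z' : Fin d × Fin D → ℂ)
    (a a' b b' : Fin d × Fin D) :
    ∫ U, (U.1.mulVec x) a * (U.1.mulVec x') a' * star ((U.1.mulVec z) b) *
        star ((U.1.mulVec z') b') ∂haarUnitary d D =
      (((d * D : ℝ) ^ 2 - 1)⁻¹ : ℝ) *
        (((star z ⬝ᵥ x) * (star z' ⬝ᵥ x') - ((d * D : ℝ)⁻¹ : ℝ) *
            ((star z' ⬝ᵥ x) * (star z ⬝ᵥ x'))) * (if a = b ∧ a' = b' then 1 else 0)
        + ((star z' ⬝ᵥ x) * (star z ⬝ᵥ x') - ((d * D : ℝ)⁻¹ : ℝ) *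
            ((star z ⬝ᵥ x) * (star z' ⬝ᵥ x'))) * (if a = b' ∧ a' = b then 1 else 0)) := by
  set T : Matrix ((Fin d × Fin D) × (Fin d × Fin D)) ((Fin d × Fin D) × (Fin d × Fin D)) ℂ :=
    Matrix.of fun p r => ∫ U, twoCopy x x' z z' U p r ∂haarUnitary d D with hTdef
  have hint : ∀ p r, Integrable (fun U => twoCopy x x' z z' U p r) (haarUnitary d D) :=
    fun p r => integrable_of_continuous_site (continuous_twoCopy x x' z z' p r)
  have hinv : ∀ g ∈ Matrix.unitaryGroup (Fin d × Fin D) ℂ, T = (g ⊗ₖ g) * T *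
      (g ⊗ₖ g).conjTranspose := by
    intro g hg
    ext p r
    simp only [Matrix.mul_apply, hTdef, Matrix.of_apply]
    rw [← integral_mul_left_eq_self (fun U => twoCopy x x' z z' U p r) (⟨g, hg⟩ : SiteUnitary d D)]
    simp only [twoCopy_mul, Matrix.mul_apply]
    rw [integral_finsetSum _ fun i _ => Integrable.mul_const (integrable_finsetSum _ fun j _ =>
      (hint _ _).const_mul _) _]
    refine Finset.sum_congr rfl fun i _ => ?_
    rw [integral_mul_const, integral_finsetSum _ fun j _ => (hint _ _).const_mul _]
    simp only [integral_const_mul]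
  have hT : ∀ g ∈ Matrix.unitaryGroup (Fin d × Fin D) ℂ, (g ⊗ₖ g) * T = T * (g ⊗ₖ g) := by
    intro g hg
    have hgg : (g ⊗ₖ g).conjTranspose * (g ⊗ₖ g) = 1 := by
      rw [Matrix.conjTranspose_kronecker, ← Matrix.mul_kronecker_mul,
        ← Matrix.star_eq_conjTranspose, Matrix.mem_unitaryGroup_iff'.1 hg,
        Matrix.one_kronecker_one]
    conv_rhs => rw [hinv g hg]
    rw [mul_assoc, hgg, mul_one]
  have t1 : ∑ y, ∑ y', T (y, y') (y, y') = (star z ⬝ᵥ x) * (star z' ⬝ᵥ x') := by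
    simp only [hTdef, Matrix.of_apply]
    simp_rw [← integral_finsetSum Finset.univ fun j _ => hint (_, j) (_, j)]
    rw [← integral_finsetSum Finset.univ fun i _ =>
      integrable_finsetSum Finset.univ fun j _ => hint (i, j) (i, j)]
    rw [integral_congr_ae (g := fun _ => (star z ⬝ᵥ x) * (star z' ⬝ᵥ x'))]
    · simp
    · refine ae_of_all _ fun U => ?_
      simp only [twoCopy, Matrix.of_apply]
      rw [← star_dotProduct_mulVec U, ← star_dotProduct_mulVec U, Finset.sum_mul_sum]
      refine Finset.sum_congr rfl fun _ _ => Finset.sum_congr rfl fun _ _ => ?_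
      ring
  have t2 : ∑ y, ∑ y', T (y, y') (y', y) = (star z' ⬝ᵥ x) * (star z ⬝ᵥ x') := by
    simp only [hTdef, Matrix.of_apply]
    simp_rw [← integral_finsetSum Finset.univ fun j _ => hint (_, j) (j, _)]
    rw [← integral_finsetSum Finset.univ fun i _ =>
      integrable_finsetSum Finset.univ fun j _ => hint (i, j) (j, i)]
    rw [integral_congr_ae (g := fun _ => (star z' ⬝ᵥ x) * (star z ⬝ᵥ x'))]
    · simp
    · refine ae_of_all _ fun U => ?_
      simp only [twoCopy, Matrix.of_apply]
      rw [← star_dotProduct_mulVec U, ← star_dotProduct_mulVec U, Finset.sum_mul_sum]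
      refine Finset.sum_congr rfl fun _ _ => Finset.sum_congr rfl fun _ _ => ?_
      ring
  have main := commutant_entry hT a a' b b'
  rw [t1, t2] at main
  have hcard : (Fintype.card (Fin d × Fin D) : ℂ) = ((d * D : ℝ) : ℂ) := by simp
  rw [hcard] at main
  have hq' : (1 : ℝ) < d * D := by exact_mod_cast hq
  generalize (d * D : ℝ) = q at *
  have h0 : (q : ℂ) ≠ 0 := by exact_mod_cast (by linarith : q ≠ 0)
  have h1 : (q : ℂ) ^ 2 - 1 ≠ 0 := by
    exact_mod_cast (by nlinarith : q ^ 2 - 1 ≠ 0)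
  have hval : ∫ U, (U.1.mulVec x) a * (U.1.mulVec x') a' * star ((U.1.mulVec z) b) *
        star ((U.1.mulVec z') b') ∂haarUnitary d D = T (a, a') (b, b') := rfl
  rw [hval]
  apply mul_left_cancel₀ (mul_ne_zero h0 h1)
  rw [main]
  push_cast
  field_simp

/-- The first moment follows from the second by tracing out one of the two copies. -/
lemma haar_first_moment (hq : 1 < d * D) (x z : Fin d × Fin D → ℂ) (a b : Fin d × Fin D) :
    ∫ U, (U.1.mulVec x) a * star ((U.1.mulVec z) b) ∂haarUnitary d D =
      ((d * D : ℝ)⁻¹ : ℝ) * (star z ⬝ᵥ x) * (if a = b then 1 else 0) := by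
  set w : Fin d × Fin D → ℂ := Pi.single a 1 with hw
  have hww : star w ⬝ᵥ w = 1 := by simp [hw, dotProduct_single]
  have hsum := Finset.sum_congr rfl fun (a' : Fin d × Fin D) (_ : a' ∈ Finset.univ) =>
    haar_second_moment hq x w z w a a' b a'
  replace hsum := (integral_finsetSum Finset.univ fun a' _ => integrable_of_continuous_site
    (continuous_twoCopy x w z w (a, a') (b, a'))).trans hsum
  simp only [twoCopy, Matrix.of_apply] at hsum
  have hl : ∀ U : SiteUnitary d D, ∑ a', (U.1.mulVec x) a * (U.1.mulVec w) a' *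
      star ((U.1.mulVec z) b) * star ((U.1.mulVec w) a') =
      (U.1.mulVec x) a * star ((U.1.mulVec z) b) := by
    intro U
    have := star_dotProduct_mulVec U w w
    rw [hww] at this
    rw [← mul_one (_ * star ((U.1.mulVec z) b)), ← this, Finset.mul_sum]
    exact Finset.sum_congr rfl fun _ _ => by ring
  simp only [hl] at hsum
  rw [hsum, hww, ← Finset.mul_sum, Finset.sum_add_distrib, ← Finset.mul_sum, ← Finset.mul_sum]
  have s1 : ∑ _a' : Fin d × Fin D, (if a = b ∧ True then (1 : ℂ) else 0)
      = ((d * D : ℝ) : ℂ) * if a = b then 1 else 0 := by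
    by_cases h : a = b <;> simp [h]
  have s2 : ∑ a' : Fin d × Fin D, (if a = a' ∧ a' = b then (1 : ℂ) else 0)
      = if a = b then 1 else 0 := by
    simp [ite_and]
  rw [s1, s2]
  have hq' : (1 : ℝ) < d * D := by exact_mod_cast hq
  generalize (d * D : ℝ) = q at *
  have h0 : (q : ℂ) ≠ 0 := by exact_mod_cast (by linarith : q ≠ 0)
  have h1 : (q : ℂ) ^ 2 - 1 ≠ 0 := by
    exact_mod_cast (by nlinarith : q ^ 2 - 1 ≠ 0)
  push_cast
  field_simp
  ring

end HaarMoments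

/-! ### Cyclic sums and traces -/

section CyclicSums

variable {K : Type*} [CommRing K]

/-- An entry of a product of matrices is a sum over paths with fixed endpoints. -/
lemma prod_ofFn_apply {m : Type*} [Fintype m] [DecidableEq m] {n : ℕ}
    (A : Fin (n + 1) → Matrix m m K) (x y : m) :
    (List.ofFn A).prod x y = ∑ b : Fin n → m, ∏ k : Fin (n + 1),
      A k (Fin.cons (α := fun _ => m) x b k) (Fin.snoc (α := fun _ => m) b y k) := by
  induction n generalizing x with
  | zero => simp [Fin.snoc]
  | succ n ih =>
    rw [List.ofFn_succ, List.prod_cons, Matrix.mul_apply]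
    simp only [ih, Finset.mul_sum]
    rw [← Fintype.sum_prod_type', ← (Fin.consEquiv fun _ : Fin (n + 1) => m).sum_comp]
    refine Finset.sum_congr rfl fun p _ => ?_
    rw [Fin.prod_univ_succ (n := n + 1)]
    simp [Fin.consEquiv, ← Fin.cons_snoc_eq_snoc_cons]

/-- The trace of a product of matrices is the sum over closed paths. -/
lemma trace_prod_ofFn {m : Type*} [Fintype m] [DecidableEq m] {n : ℕ}
    (A : Fin (n + 1) → Matrix m m K) :
    (List.ofFn A).prod.trace = ∑ b : Fin (n + 1) → m, ∏ k, A k (b k) (b (k + 1)) := by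
  simp only [Matrix.trace, Matrix.diag_apply, prod_ofFn_apply]
  rw [← Fintype.sum_prod_type', ← (Fin.consEquiv fun _ : Fin (n + 1) => m).sum_comp]
  refine Finset.sum_congr rfl fun p _ => Finset.prod_congr rfl fun k _ => ?_
  simp only [Fin.consEquiv, Equiv.coe_fn_mk]
  congr 1
  refine Fin.lastCases ?_ (fun j => ?_) k
  · simp
  · simp

lemma trace_pow_eq_sum {m : Type*} [Fintype m] [DecidableEq m] {n : ℕ} (A : Matrix m m K) :
    (A ^ (n + 1)).trace = ∑ b : Fin (n + 1) → m, ∏ k, A (b k) (b (k + 1)) := by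
  rw [← trace_prod_ofFn fun _ => A, List.ofFn_const, List.prod_replicate]

/-- Contraction of a ring of tensors, each of which is a sum over `σ ∈ R` of products of a left and
a right factor: the bond variables `β` can be summed out bond by bond, which leaves a sum over
configurations `σ` with nearest-neighbour weights. -/
lemma sum_prod_factored {R B : Type*} [Fintype R] [DecidableEq R] [Fintype B] [DecidableEq B]
    {n : ℕ} (p : Fin (n + 1) → R → K) (g v : R → B → K) :
    ∑ β : Fin (n + 1) → B, ∏ k, ∑ σ, p k σ * g σ (β k) * v σ (β (k + 1)) =
      ∑ σ : Fin (n + 1) → R, (∏ k, p k (σ k)) * ∏ k, ∑ b, v (σ k) b * g (σ (k + 1)) b := by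
  simp only [Finset.prod_univ_sum, Fintype.piFinset_univ]
  rw [Finset.sum_comm]
  refine Finset.sum_congr rfl fun σ _ => ?_
  simp only [Finset.prod_mul_distrib, mul_assoc]
  rw [← Finset.mul_sum]
  congr 1
  rw [← ((Equiv.addRight (1 : Fin (n + 1))).arrowCongr (Equiv.refl B)).sum_comp]
  refine Finset.sum_congr rfl fun β _ => ?_
  rw [mul_comm]
  congr 1
  · simp [Equiv.arrowCongr]
  · rw [← Equiv.prod_comp (Equiv.addRight (1 : Fin (n + 1)))]
    simp [Equiv.arrowCongr]

lemma sum_mul_sum_arrow {X Y I : Type*} [Fintype X] [Fintype Y] [Fintype I] [DecidableEq I]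
    (f : (I → X) → K) (g : (I → Y) → K) :
    (∑ b, f b) * ∑ b, g b = ∑ p : I → X × Y, f (fun k => (p k).1) * g (fun k => (p k).2) := by
  rw [Finset.sum_mul_sum, ← Fintype.sum_prod_type',
    ← (Equiv.arrowProdEquivProdArrow I (fun _ => X) (fun _ => Y)).sum_comp]
  rfl

/-- The trace of a power of a `2 × 2` matrix in terms of its eigenvalues `x, y`, by the
Cayley–Hamilton recursion. -/
lemma trace_pow_fin_two (A : Matrix (Fin 2) (Fin 2) K) {x y : K} (ht : A 0 0 + A 1 1 = x + y)
    (hd : A 0 0 * A 1 1 - A 0 1 * A 1 0 = x * y) (n : ℕ) : (A ^ n).trace = x ^ n + y ^ n := by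
  have h2 : A ^ 2 = (x + y) • A - (x * y) • (1 : Matrix (Fin 2) (Fin 2) K) := by
    rw [← ht, ← hd]
    ext i j
    fin_cases i <;> fin_cases j <;> simp [pow_two, Matrix.mul_apply, Fin.sum_univ_two] <;> ring
  induction n using Nat.twoStepInduction with
  | zero => simp [Matrix.trace, one_add_one_eq_two]
  | one => simpa [Matrix.trace, Fin.sum_univ_two] using ht
  | more n h0 h1 =>
    rw [pow_add, h2, mul_sub, Matrix.mul_smul, Matrix.mul_smul, mul_one, ← pow_succ,
      Matrix.trace_sub, Matrix.trace_smul, Matrix.trace_smul, h0, h1]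
    simp only [smul_eq_mul]
    ring

end CyclicSums

/-! ### The average of a single site -/

section SiteMoments

variable {d D : ℕ}

/-- The vector `v ⊗ |b⟩`, in the product basis. -/
def inputVector (v : EuclideanSpace ℂ (Fin d)) (b : Fin D) : Fin d × Fin D → ℂ :=
  fun p => if p.2 = b then v p.1 else 0

lemma siteTensor_apply (v : EuclideanSpace ℂ (Fin d)) (U : SiteUnitary d D) (i : Fin d)
    (a b : Fin D) : siteTensor v U i a b = U.1.mulVec (inputVector v b) (i, a) := by
  simp [siteTensor, Matrix.mulVec, dotProduct, inputVector, Fintype.sum_prod_type]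

lemma star_inputVector_dotProduct {v : EuclideanSpace ℂ (Fin d)} (hv : ‖v‖ = 1) (b f : Fin D) :
    star (inputVector v f) ⬝ᵥ inputVector v b = if b = f then 1 else 0 := by
  have h : ∑ j, star (v j) * v j = 1 := by
    have := EuclideanSpace.norm_sq_eq v
    rw [hv] at this
    have h2 : ∀ j, star (v j) * v j = ((‖v j‖ ^ 2 : ℝ) : ℂ) := fun j => by
      simpa using Complex.conj_mul' (v j)
    simp_rw [h2]
    rw [← Complex.ofReal_sum, ← this]
    simp
  simp only [dotProduct, inputVector, Fintype.sum_prod_type, Pi.star_apply]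
  by_cases hbf : b = f
  · subst hbf
    simpa [apply_ite] using h
  · simp only [hbf, if_false]
    refine Finset.sum_eq_zero fun i _ => Finset.sum_eq_zero fun c _ => ?_
    by_cases hc : c = b
    · simp [hc, hbf]
    · simp [hc]

/-- Quadruples of indices `((x, x'), (y, y'))`: the indices `x, x'` of two copies of a tensor, and
the indices `y, y'` of two copies of its conjugate. -/
abbrev Quad (X : Type*) : Type _ := (X × X) × (X × X)

/-- The matrix element `⟨x x'|P_σ|y y'⟩` of the identity (`σ = 0`) or the swap (`σ = 1`). -/
def pairing {X : Type*} [DecidableEq X] (σ : Fin 2) (p : Quad X) : ℂ :=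
  if σ = 0 then (if p.1 = p.2 then 1 else 0) else (if p.1 = p.2.swap then 1 else 0)

/-- The Weingarten function of `U(q)` for two copies, where `0` and `1` stand for the identity and
the transposition. -/
def weingarten (q : ℝ) (σ τ : Fin 2) : ℝ := (q ^ 2 - 1)⁻¹ * if σ = τ then 1 else -q⁻¹

/-- Two copies of the tensor of one site times two copies of its conjugate. -/
def siteQuad (v : EuclideanSpace ℂ (Fin d)) (s : Quad (Fin d)) (β β' : Quad (Fin D))
    (U : SiteUnitary d D) : ℂ :=
  siteTensor v U s.1.1 β.1.1 β'.1.1 * siteTensor v U s.1.2 β.1.2 β'.1.2 *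
    (star (siteTensor v U s.2.1 β.2.1 β'.2.1) * star (siteTensor v U s.2.2 β.2.2 β'.2.2))

lemma continuous_siteTensor_apply (v : EuclideanSpace ℂ (Fin d)) (i : Fin d) (a b : Fin D) :
    Continuous fun U : SiteUnitary d D => siteTensor v U i a b := by
  simp only [siteTensor_apply]
  exact continuous_mulVec_apply _ _

lemma continuous_siteQuad (v : EuclideanSpace ℂ (Fin d)) (s : Quad (Fin d))
    (β β' : Quad (Fin D)) : Continuous (siteQuad v s β β') := by
  have := continuous_siteTensor_apply (D := D) v
  unfold siteQuad
  fun_prop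

/-- The average of one site: a sum over pairs of permutations, `σ` acting on the outputs (physical
and left bond) and `τ` on the input (right bond). -/
lemma integral_siteQuad (hq : 1 < d * D) {v : EuclideanSpace ℂ (Fin d)} (hv : ‖v‖ = 1)
    (s : Quad (Fin d)) (β β' : Quad (Fin D)) :
    ∫ U, siteQuad v s β β' U ∂haarUnitary d D =
      ∑ σ, pairing σ s * pairing σ β * ∑ τ, (weingarten (d * D) σ τ : ℂ) * pairing τ β' := by
  obtain ⟨⟨i, i'⟩, ⟨j, j'⟩⟩ := s
  obtain ⟨⟨b, b'⟩, ⟨f, f'⟩⟩ := β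
  obtain ⟨⟨c, c'⟩, ⟨g, g'⟩⟩ := β'
  have h := haar_second_moment hq (inputVector v c) (inputVector v c') (inputVector v g)
    (inputVector v g') (i, b) (i', b') (j, f) (j', f')
  simp only [star_inputVector_dotProduct hv] at h
  simp only [siteQuad, siteTensor_apply, ← mul_assoc]
  rw [h]
  simp only [Fin.sum_univ_two, pairing, weingarten, Prod.mk.injEq, Prod.swap_prod_mk]
  have e1 : ∀ P Q R S : Prop, ∀ [Decidable P] [Decidable Q] [Decidable R] [Decidable S],
      (if (P ∧ Q) ∧ R ∧ S then (1 : ℂ) else 0)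
        = (if P ∧ R then 1 else 0) * (if Q ∧ S then 1 else 0) := by
    intro P Q R S _ _ _ _
    by_cases P <;> by_cases Q <;> by_cases R <;> by_cases S <;> simp_all
  have e2 : ∀ P Q : Prop, ∀ [Decidable P] [Decidable Q],
      (if P then (1 : ℂ) else 0) * (if Q then 1 else 0) = (if P ∧ Q then 1 else 0) := by
    intro P Q _ _
    by_cases P <;> by_cases Q <;> simp_all
  rw [e1, e1, e2, e2]
  generalize (if c = g ∧ c' = g' then (1 : ℂ) else 0) = t₁,
    (if c = g' ∧ c' = g then (1 : ℂ) else 0) = t₂,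
    (if i = j ∧ i' = j' then (1 : ℂ) else 0) = u₁,
    (if i = j' ∧ i' = j then (1 : ℂ) else 0) = u₂,
    (if b = f ∧ b' = f' then (1 : ℂ) else 0) = w₁,
    (if b = f' ∧ b' = f then (1 : ℂ) else 0) = w₂
  simp
  ring

/-- The nearest-neighbour weight of the permutations `σ, σ'` of two adjacent sites, obtained by
summing out the bond between them: the Weingarten matrix times the Gram matrix of the permutation
operators on the bond space. -/
def domainWall (d D : ℕ) : Matrix (Fin 2) (Fin 2) ℝ :=
  Matrix.of fun σ σ' => if σ = σ' then ((D : ℝ) ^ 2 - (d : ℝ)⁻¹) / ((d * D : ℝ) ^ 2 - 1)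
    else (D - D / d) / ((d * D : ℝ) ^ 2 - 1)

lemma sum_pairing_mul_pairing {X : Type*} [DecidableEq X] [Fintype X] (σ τ : Fin 2) :
    ∑ b : Quad X, pairing σ b * pairing τ b
      = if σ = τ then (Fintype.card X : ℂ) ^ 2 else Fintype.card X := by
  have h : ∑ x : X × X, (if x = x.swap then (1 : ℂ) else 0) = Fintype.card X := by
    rw [Fintype.sum_prod_type]
    have : ∀ x y : X, ((x, y) = (x, y).swap) ↔ x = y := fun x y => by
      simp only [Prod.swap_prod_mk, Prod.mk.injEq]
      exact ⟨fun h => h.1, fun h => ⟨h, h.symm⟩⟩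
    simp only [this]
    simp
  rw [Fintype.sum_prod_type]
  have hsw : ∀ x y : X × X, x = y.swap ↔ y = x.swap := fun x y => by
    constructor <;> rintro rfl <;> simp
  fin_cases σ <;> fin_cases τ
  · simp [pairing, Fintype.card_prod, pow_two]
  · simpa [pairing, hsw, -Finset.sum_boole] using h
  · simpa [pairing, hsw, -Finset.sum_boole] using h
  · simp [pairing, hsw, Fintype.card_prod, pow_two]

lemma sum_weingarten_mul_pairing (hq : 1 < d * D) (σ σ' : Fin 2) :
    ∑ b : Quad (Fin D), (∑ τ, (weingarten (d * D) σ τ : ℂ) * pairing τ b) * pairing σ' b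
      = (domainWall d D σ σ' : ℂ) := by
  simp only [Finset.sum_mul]
  rw [Finset.sum_comm]
  simp only [mul_assoc, ← Finset.mul_sum, sum_pairing_mul_pairing]
  have hd : (d : ℂ) ≠ 0 := by
    rintro h
    have : d = 0 := by exact_mod_cast h
    simp [this] at hq
  have hD : (D : ℂ) ≠ 0 := by
    rintro h
    have : D = 0 := by exact_mod_cast h
    simp [this] at hq
  fin_cases σ <;> fin_cases σ' <;> simp [Fin.sum_univ_two, weingarten, domainWall] <;>
    field_simp <;> ring

end SiteMoments

/-! ### Averages of random matrix product states -/

section StateMoments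

variable {d D m : ℕ}

/-- The joint law of the unitaries `U^{(1)}, …, U^{(n)}`. -/
def jointHaar (d D n : ℕ) : Measure (Fin n → SiteUnitary d D) :=
  Measure.pi fun _ => haarUnitary d D

instance instIsProbabilityMeasureJointHaar (n : ℕ) : IsProbabilityMeasure (jointHaar d D n) := by
  unfold jointHaar; infer_instance

lemma integrable_of_continuous_sites {n : ℕ} {E : Type*} [NormedAddCommGroup E]
    {f : (Fin n → SiteUnitary d D) → E}
    (hf : Continuous f) : Integrable f (jointHaar d D n) :=
  hf.integrable_of_hasCompactSupport (HasCompactSupport.of_compactSpace f)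

lemma mps_apply (v : EuclideanSpace ℂ (Fin d)) (U : Fin (m + 1) → SiteUnitary d D)
    (i : Fin (m + 1) → Fin d) :
    mps v U i = ∑ b : Fin (m + 1) → Fin D, ∏ k, siteTensor v (U k) (i k) (b k) (b (k + 1)) := by
  simp only [mps]
  exact trace_prod_ofFn _

/-- Every basis vector has the same mean weight in a random matrix product state. -/
lemma integral_mps_pair (hq : 1 < d * D) {v : EuclideanSpace ℂ (Fin d)} (hv : ‖v‖ = 1)
    (i : Fin (m + 1) → Fin d) :
    ∫ U, mps v U i * star (mps v U i) ∂jointHaar d D (m + 1) = ((d : ℂ)⁻¹) ^ (m + 1) := by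
  have hexp : ∀ U : Fin (m + 1) → SiteUnitary d D, mps v U i * star (mps v U i) =
      ∑ β : Fin (m + 1) → Fin D × Fin D, ∏ k, (siteTensor v (U k) (i k) (β k).1 (β (k + 1)).1 *
        star (siteTensor v (U k) (i k) (β k).2 (β (k + 1)).2)) := by
    intro U
    simp only [mps_apply, star_sum, star_prod]
    rw [sum_mul_sum_arrow]
    simp only [Finset.prod_mul_distrib]
  have hone : ∀ (x : Fin d) (β β' : Fin D × Fin D), ∫ U, siteTensor v U x β.1 β'.1 *
      star (siteTensor v U x β.2 β'.2) ∂haarUnitary d D =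
      ∑ _σ : Unit, (((d * D : ℝ)⁻¹ : ℝ) : ℂ) * (if β.1 = β.2 then 1 else 0) *
        (if β'.1 = β'.2 then 1 else 0) := by
    intro x β β'
    simp only [siteTensor_apply, haar_first_moment hq, star_inputVector_dotProduct hv,
      Prod.mk.injEq, true_and, Finset.univ_unique, Finset.sum_singleton]
    ring
  simp only [hexp]
  rw [integral_finsetSum _ fun β _ => integrable_of_continuous_sites (by
    have := continuous_siteTensor_apply (D := D) v
    fun_prop)]
  have hprod : ∀ β : Fin (m + 1) → Fin D × Fin D,
      ∫ U, ∏ k, (siteTensor v (U k) (i k) (β k).1 (β (k + 1)).1 *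
        star (siteTensor v (U k) (i k) (β k).2 (β (k + 1)).2)) ∂jointHaar d D (m + 1) =
      ∏ k, ∑ _σ : Unit, (((d * D : ℝ)⁻¹ : ℝ) : ℂ) * (if (β k).1 = (β k).2 then 1 else 0) *
        (if (β (k + 1)).1 = (β (k + 1)).2 then 1 else 0) := by
    intro β
    rw [jointHaar, integral_fintype_prod_eq_prod (f := fun k (V : SiteUnitary d D) =>
      siteTensor v V (i k) (β k).1 (β (k + 1)).1 *
        star (siteTensor v V (i k) (β k).2 (β (k + 1)).2))]
    exact Finset.prod_congr rfl fun k _ => hone _ _ _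
  simp only [hprod]
  rw [sum_prod_factored (fun _ _ => (((d * D : ℝ)⁻¹ : ℝ) : ℂ))
    (fun (_ : Unit) (β : Fin D × Fin D) => if β.1 = β.2 then 1 else 0)
    (fun (_ : Unit) (β : Fin D × Fin D) => if β.1 = β.2 then 1 else 0)]
  have hb : ∑ b : Fin D × Fin D, (if b.1 = b.2 then (1 : ℂ) else 0) *
      (if b.1 = b.2 then 1 else 0) = D := by
    rw [Fintype.sum_prod_type]
    simp
  have hD : (D : ℂ) ≠ 0 := by
    rintro h
    have : D = 0 := by exact_mod_cast h
    simp [this] at hq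
  simp only [hb, Finset.univ_unique, Finset.sum_singleton, Finset.prod_const, Finset.card_univ,
    Fintype.card_fin]
  rw [← mul_pow]
  congr 1
  push_cast
  field_simp

/-- The average of `ψ ⊗ ψ ⊗ ψ̄ ⊗ ψ̄` is the partition function of a periodic Ising chain, with one
permutation of two copies at each site. -/
lemma integral_mps_quad (hq : 1 < d * D) {v : EuclideanSpace ℂ (Fin d)} (hv : ‖v‖ = 1)
    (s : Fin (m + 1) → Quad (Fin d)) :
    ∫ U, mps v U (fun k => (s k).1.1) * mps v U (fun k => (s k).1.2) *
        (star (mps v U fun k => (s k).2.1) * star (mps v U fun k => (s k).2.2))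
        ∂jointHaar d D (m + 1) =
      ∑ σ : Fin (m + 1) → Fin 2, (∏ k, pairing (σ k) (s k)) *
        ((∏ k, domainWall d D (σ k) (σ (k + 1)) : ℝ) : ℂ) := by
  have hexp : ∀ U : Fin (m + 1) → SiteUnitary d D,
      mps v U (fun k => (s k).1.1) * mps v U (fun k => (s k).1.2) *
        (star (mps v U fun k => (s k).2.1) * star (mps v U fun k => (s k).2.2)) =
      ∑ β : Fin (m + 1) → Quad (Fin D), ∏ k, siteQuad v (s k) (β k) (β (k + 1)) (U k) := by
    intro U
    simp only [mps_apply, star_sum, star_prod]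
    simp only [sum_mul_sum_arrow, ← Finset.prod_mul_distrib]
    rfl
  simp only [hexp]
  rw [integral_finsetSum _ fun β _ => integrable_of_continuous_sites (by
    have := continuous_siteQuad (D := D) v
    fun_prop)]
  have hprod : ∀ β : Fin (m + 1) → Quad (Fin D),
      ∫ U, ∏ k, siteQuad v (s k) (β k) (β (k + 1)) (U k) ∂jointHaar d D (m + 1) =
      ∏ k, ∑ σ, pairing σ (s k) * pairing σ (β k) *
        ∑ τ, (weingarten (d * D) σ τ : ℂ) * pairing τ (β (k + 1)) := by
    intro β
    rw [jointHaar, integral_fintype_prod_eq_prod (f := fun k => siteQuad v (s k) (β k) (β (k + 1)))]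
    exact Finset.prod_congr rfl fun k _ => integral_siteQuad hq hv _ _ _
  simp only [hprod]
  rw [sum_prod_factored (fun k σ => pairing σ (s k)) (fun σ β => pairing σ β)
    (fun σ β => ∑ τ, (weingarten (d * D) σ τ : ℂ) * pairing τ β)]
  simp only [sum_weingarten_mul_pairing hq]
  push_cast
  rfl

end StateMoments

/-! ### Norm and overlaps of random matrix product states -/

section MomentBounds

variable {d D m : ℕ}

lemma continuous_mps_apply {n : ℕ} (v : EuclideanSpace ℂ (Fin d)) (i : Fin n → Fin d) :
    Continuous fun U : Fin n → SiteUnitary d D => mps v U i :=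
  (PiLp.continuous_apply 2 _ i).comp (continuous_mps v)

lemma coe_norm_sq_eq_sum {n : ℕ} (ψ : StateSpace n d) :
    ((‖ψ‖ ^ 2 : ℝ) : ℂ) = ∑ i, ψ i * star (ψ i) := by
  rw [EuclideanSpace.norm_sq_eq]
  push_cast
  exact Finset.sum_congr rfl fun i _ => (Complex.mul_conj' (ψ i)).symm

lemma integral_norm_sq_mps (hq : 1 < d * D) {v : EuclideanSpace ℂ (Fin d)} (hv : ‖v‖ = 1) :
    ∫ U, ‖mps v U‖ ^ 2 ∂jointHaar d D (m + 1) = 1 := by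
  have hd : (d : ℂ) ≠ 0 := by
    rintro h
    have : d = 0 := by exact_mod_cast h
    simp [this] at hq
  apply Complex.ofReal_injective
  rw [← integral_complex_ofReal]
  simp only [coe_norm_sq_eq_sum]
  have hc := continuous_mps_apply (n := m + 1) (D := D) v
  rw [integral_finsetSum _ fun i _ => integrable_of_continuous_sites (by fun_prop)]
  simp only [integral_mps_pair hq hv, Finset.sum_const, Finset.card_univ, Fintype.card_pi,
    Fintype.card_fin, Finset.prod_const, nsmul_eq_mul]
  push_cast
  rw [← mul_pow, mul_inv_cancel₀ hd, one_pow]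

/-- The second moment of the squared norm is the trace of the `n`-th power of a transfer matrix with
eigenvalues `1` and `d(D² - 1)/(d²D² - 1)`. -/
lemma integral_norm_pow_four_mps (hq : 1 < d * D) {v : EuclideanSpace ℂ (Fin d)} (hv : ‖v‖ = 1) :
    ∫ U, (‖mps v U‖ ^ 2) ^ 2 ∂jointHaar d D (m + 1) =
      1 + (d * ((D : ℝ) ^ 2 - 1) / ((d * D : ℝ) ^ 2 - 1)) ^ (m + 1) := by
  have hd : (d : ℝ) ≠ 0 := by
    rintro h
    have : d = 0 := by exact_mod_cast h
    simp [this] at hq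
  have hq' : (1 : ℝ) < d * D := by exact_mod_cast hq
  have h1 : (d : ℝ) ^ 2 * (D : ℝ) ^ 2 - 1 ≠ 0 := by nlinarith
  set T : Matrix (Fin 2) (Fin 2) ℝ :=
    Matrix.of fun σ σ' => (if σ = 0 then (d : ℝ) ^ 2 else d) * domainWall d D σ σ' with hT
  have htr : (T ^ (m + 1)).trace = 1 ^ (m + 1) +
      (d * ((D : ℝ) ^ 2 - 1) / ((d * D : ℝ) ^ 2 - 1)) ^ (m + 1) := by
    apply trace_pow_fin_two
    · simp [hT, domainWall, mul_pow]
      field_simp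
      ring
    · simp [hT, domainWall, mul_pow]
      field_simp
      ring
  rw [one_pow] at htr
  rw [← htr, trace_pow_eq_sum]
  apply Complex.ofReal_injective
  rw [← integral_complex_ofReal]
  have hexp : ∀ U : Fin (m + 1) → SiteUnitary d D, (((‖mps v U‖ ^ 2) ^ 2 : ℝ) : ℂ) =
      ∑ s : Fin (m + 1) → Fin d × Fin d,
        mps v U (fun k => (s k).1) * mps v U (fun k => (s k).2) *
          (star (mps v U fun k => (s k).1) * star (mps v U fun k => (s k).2)) := by
    intro U
    rw [Complex.ofReal_pow, coe_norm_sq_eq_sum, pow_two, sum_mul_sum_arrow]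
    exact Finset.sum_congr rfl fun s _ => by ring
  simp only [hexp]
  have hc := continuous_mps_apply (n := m + 1) (D := D) v
  rw [integral_finsetSum _ fun i _ => integrable_of_continuous_sites (by fun_prop)]
  have hs := fun s : Fin (m + 1) → Fin d × Fin d =>
    integral_mps_quad hq hv (m := m) (fun k => (s k, s k))
  simp only at hs
  simp only [hs]
  rw [Finset.sum_comm]
  push_cast
  refine Finset.sum_congr rfl fun σ _ => ?_
  rw [← Finset.sum_mul]
  have hp : ∑ s : Fin (m + 1) → Fin d × Fin d, ∏ k, pairing (σ k) (s k, s k)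
      = ∏ k, ∑ x : Fin d × Fin d, pairing (σ k) (x, x) := by
    simp only [Finset.prod_univ_sum, Fintype.piFinset_univ]
  rw [hp, ← Finset.prod_mul_distrib]
  refine Finset.prod_congr rfl fun k _ => ?_
  have hx : ∀ τ : Fin 2, ∑ x : Fin d × Fin d, pairing τ (x, x)
      = (((if τ = 0 then (d : ℝ) ^ 2 else d : ℝ)) : ℂ) := by
    intro τ
    have h := sum_pairing_mul_pairing (X := Fin d) 0 τ
    rw [Fintype.sum_prod_type] at h
    simp only [pairing, if_true, ite_mul, one_mul, zero_mul, Finset.sum_ite_eq,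
      Finset.mem_univ] at h ⊢
    rw [h]
    by_cases h0 : τ = 0 <;> simp [h0, eq_comm]
  rw [hx, ← Complex.ofReal_mul]
  rfl

/-- Permute the two copies at the sites where `σ = 1`. -/
def swapAt {n : ℕ} {X : Type*} (σ : Fin n → Fin 2) (p : Fin n → X × X) : Fin n → X × X :=
  fun k => if σ k = 0 then p k else (p k).swap

lemma swapAt_involutive {n : ℕ} {X : Type*} (σ : Fin n → Fin 2) :
    Function.Involutive (swapAt (X := X) σ) := by
  intro p
  funext k
  by_cases h : σ k = 0 <;> simp [swapAt, h]

lemma prod_pairing {n : ℕ} {X : Type*} [DecidableEq X] (σ : Fin n → Fin 2)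
    (p r : Fin n → X × X) :
    ∏ k, pairing (σ k) (p k, r k) = if r = swapAt σ p then 1 else 0 := by
  have h : ∀ k, pairing (σ k) (p k, r k) = if r k = swapAt σ p k then 1 else 0 := by
    intro k
    have hsw : ∀ x y : X × X, x = y.swap ↔ y = x.swap := fun x y => by
      constructor <;> rintro rfl <;> simp
    by_cases h : σ k = 0
    · simp [pairing, swapAt, h, eq_comm]
    · simp [pairing, swapAt, h, hsw]
  simp only [h, Finset.prod_boole, Finset.mem_univ, forall_const]
  simp only [funext_iff]

/-- Purity of a subsystem is at most one: permuting some of the tensor factors of `e ⊗ e` gives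
a vector whose overlap with `e ⊗ e` is at most `1`. -/
lemma norm_sum_swap_overlap_le {n : ℕ} {e : StateSpace n d} (he : ‖e‖ = 1) (σ : Fin n → Fin 2) :
    ‖∑ s : Fin n → Quad (Fin d), star (e fun k => (s k).1.1) * star (e fun k => (s k).1.2) *
        (e (fun k => (s k).2.1) * e (fun k => (s k).2.2)) * ∏ k, pairing (σ k) (s k)‖ ≤ 1 := by
  set C : (Fin n → Fin d × Fin d) → ℂ := fun p => e (fun k => (p k).1) * e (fun k => (p k).2)
    with hC
  have hsum : ∑ s : Fin n → Quad (Fin d), star (e fun k => (s k).1.1) *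
        star (e fun k => (s k).1.2) *
        (e (fun k => (s k).2.1) * e (fun k => (s k).2.2)) * ∏ k, pairing (σ k) (s k)
      = ∑ p, star (C p) * C (swapAt σ p) := by
    rw [← (Equiv.arrowProdEquivProdArrow (Fin n) (fun _ => Fin d × Fin d)
      (fun _ => Fin d × Fin d)).symm.sum_comp, Fintype.sum_prod_type]
    refine Finset.sum_congr rfl fun p _ => ?_
    simp only [Equiv.arrowProdEquivProdArrow, Equiv.coe_fn_symm_mk, prod_pairing]
    simp [hC]
  have hC1 : ∑ p, ‖C p‖ ^ 2 = 1 := by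
    have h := EuclideanSpace.norm_sq_eq e
    rw [he, one_pow] at h
    have h2 := sum_mul_sum_arrow (fun i => ‖e i‖ ^ 2) (fun i => ‖e i‖ ^ 2)
    rw [← h, one_mul] at h2
    rw [h2]
    exact Finset.sum_congr rfl fun p _ => by simp only [hC, norm_mul]; ring
  rw [hsum]
  calc ‖∑ p, star (C p) * C (swapAt σ p)‖ ≤ ∑ p, ‖star (C p) * C (swapAt σ p)‖ :=
        norm_sum_le _ _
    _ ≤ ∑ p, (‖C p‖ ^ 2 + ‖C (swapAt σ p)‖ ^ 2) / 2 := by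
        refine Finset.sum_le_sum fun p _ => ?_
        rw [norm_mul, norm_star]
        nlinarith [sq_nonneg (‖C p‖ - ‖C (swapAt σ p)‖)]
    _ = 1 := by
        have hperm : ∑ p, ‖C (swapAt σ p)‖ ^ 2 = ∑ p, ‖C p‖ ^ 2 :=
          Equiv.sum_comp (swapAt_involutive (X := Fin d) σ).toPerm fun p => ‖C p‖ ^ 2
        rw [← Finset.sum_div, Finset.sum_add_distrib, hperm, hC1]
        norm_num

lemma domainWall_nonneg (hq : 1 < d * D) (σ σ' : Fin 2) : 0 ≤ domainWall d D σ σ' := by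
  have hd : 1 ≤ d := Nat.pos_of_ne_zero fun h => by simp [h] at hq
  have hD : 1 ≤ D := Nat.pos_of_ne_zero fun h => by simp [h] at hq
  have hd' : (1 : ℝ) ≤ d := by exact_mod_cast hd
  have hD' : (1 : ℝ) ≤ D := by exact_mod_cast hD
  have hq' : (1 : ℝ) < d * D := by exact_mod_cast hq
  have h1 : 0 ≤ (d * D : ℝ) ^ 2 - 1 := by nlinarith
  have hinv : (d : ℝ)⁻¹ ≤ 1 := inv_le_one_of_one_le₀ hd'
  have h2 : (D : ℝ) / d ≤ D := div_le_self (by linarith) hd'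
  simp only [domainWall, Matrix.of_apply]
  split_ifs
  · exact div_nonneg (by nlinarith) h1
  · exact div_nonneg (by linarith) h1

lemma domainWall_trace_aux {d D : ℝ} (hd : d ≠ 0) (h2 : d * D - 1 ≠ 0) (h3 : d * D + 1 ≠ 0) :
    (D ^ 2 - d⁻¹) / ((d * D) ^ 2 - 1) + (D ^ 2 - d⁻¹) / ((d * D) ^ 2 - 1) =
      (D + 1) / (d * (d * D + 1)) + (D - 1) / (d * (d * D - 1)) := by
  have h4 : (d * D) ^ 2 - 1 ≠ 0 := by
    rw [show (d * D) ^ 2 - 1 = (d * D - 1) * (d * D + 1) by ring]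
    exact mul_ne_zero h2 h3
  rw [← add_div, div_add_div _ _ (mul_ne_zero hd h3) (mul_ne_zero hd h2),
    div_eq_div_iff h4 (mul_ne_zero (mul_ne_zero hd h3) (mul_ne_zero hd h2))]
  field_simp
  ring

lemma domainWall_det_aux {d D : ℝ} (hd : d ≠ 0) (h2 : d * D - 1 ≠ 0) (h3 : d * D + 1 ≠ 0) :
    (D ^ 2 - d⁻¹) / ((d * D) ^ 2 - 1) * ((D ^ 2 - d⁻¹) / ((d * D) ^ 2 - 1))
      - (D - D / d) / ((d * D) ^ 2 - 1) * ((D - D / d) / ((d * D) ^ 2 - 1)) =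
      (D + 1) / (d * (d * D + 1)) * ((D - 1) / (d * (d * D - 1))) := by
  have h4 : (d * D) ^ 2 - 1 ≠ 0 := by
    rw [show (d * D) ^ 2 - 1 = (d * D - 1) * (d * D + 1) by ring]
    exact mul_ne_zero h2 h3
  rw [div_mul_div_comm, div_mul_div_comm, div_mul_div_comm, ← sub_div,
    div_eq_div_iff (mul_ne_zero h4 h4) (mul_ne_zero (mul_ne_zero hd h3) (mul_ne_zero hd h2))]
  field_simp
  ring

/-- The overlap with a fixed unit vector: all Ising weights are nonnegative and multiply purities,
which are at most one. -/
lemma integral_overlap_pow_four_le (hq : 1 < d * D) {v : EuclideanSpace ℂ (Fin d)} (hv : ‖v‖ = 1)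
    {e : StateSpace (m + 1) d} (he : ‖e‖ = 1) :
    ∫ U, ‖inner ℂ e (mps v U)‖ ^ 4 ∂jointHaar d D (m + 1) ≤
      2 * ((D + 1) / (d * (d * D + 1)) : ℝ) ^ (m + 1) := by
  have hd : 1 ≤ d := Nat.pos_of_ne_zero fun h => by simp [h] at hq
  have hD : 1 ≤ D := Nat.pos_of_ne_zero fun h => by simp [h] at hq
  have hd' : (1 : ℝ) ≤ d := by exact_mod_cast hd
  have hD' : (1 : ℝ) ≤ D := by exact_mod_cast hD
  have hq' : (1 : ℝ) < d * D := by exact_mod_cast hq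
  set c : (Fin (m + 1) → Quad (Fin d)) → ℂ := fun s =>
    star (e fun k => (s k).1.1) * star (e fun k => (s k).1.2) *
        (e (fun k => (s k).2.1) * e (fun k => (s k).2.2)) with hcdef
  have hexp : ∀ U : Fin (m + 1) → SiteUnitary d D, ((‖inner ℂ e (mps v U)‖ ^ 4 : ℝ) : ℂ) =
      ∑ s : Fin (m + 1) → Quad (Fin d), c s *
        (mps v U (fun k => (s k).1.1) * mps v U (fun k => (s k).1.2) *
          (star (mps v U fun k => (s k).2.1) * star (mps v U fun k => (s k).2.2))) := by
    intro U
    set ψ := mps v U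
    have hz : inner ℂ e ψ = ∑ i, star (e i) * ψ i := by
      simp [PiLp.inner_apply, mul_comm]
    have h4 : ((‖inner ℂ e ψ‖ ^ 4 : ℝ) : ℂ) = (inner ℂ e ψ * inner ℂ e ψ) *
        (star (inner ℂ e ψ) * star (inner ℂ e ψ)) := by
      have := Complex.mul_conj' (inner ℂ e ψ)
      push_cast
      rw [show (4 : ℕ) = 2 * 2 from rfl, pow_mul, ← this, Complex.star_def]
      ring
    rw [h4, hz]
    simp only [star_sum, star_mul', star_star]
    simp only [sum_mul_sum_arrow]
    refine Finset.sum_congr rfl fun s _ => ?_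
    simp only [hcdef]
    ring
  have hint : ((∫ U, ‖inner ℂ e (mps v U)‖ ^ 4 ∂jointHaar d D (m + 1) : ℝ) : ℂ) =
      ∑ σ : Fin (m + 1) → Fin 2, (∑ s, c s * ∏ k, pairing (σ k) (s k)) *
        ((∏ k, domainWall d D (σ k) (σ (k + 1)) : ℝ) : ℂ) := by
    rw [← integral_complex_ofReal]
    simp only [hexp]
    have hc := continuous_mps_apply (n := m + 1) (D := D) v
    rw [integral_finsetSum _ fun i _ => integrable_of_continuous_sites (by fun_prop)]
    simp only [integral_const_mul, integral_mps_quad hq hv, Finset.mul_sum, Finset.sum_mul]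
    rw [Finset.sum_comm]
    exact Finset.sum_congr rfl fun _ _ => Finset.sum_congr rfl fun _ _ => by ring
  have hle : ∫ U, ‖inner ℂ e (mps v U)‖ ^ 4 ∂jointHaar d D (m + 1) ≤
      (domainWall d D ^ (m + 1)).trace := by
    refine (le_abs_self _).trans ?_
    rw [← Real.norm_eq_abs, ← Complex.norm_real, hint, trace_pow_eq_sum]
    refine (norm_sum_le _ _).trans (Finset.sum_le_sum fun σ _ => ?_)
    have hnn : 0 ≤ ∏ k, domainWall d D (σ k) (σ (k + 1)) :=
      Finset.prod_nonneg fun k _ => domainWall_nonneg hq _ _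
    rw [norm_mul, Complex.norm_real, Real.norm_of_nonneg hnn]
    exact mul_le_of_le_one_left hnn (norm_sum_swap_overlap_le he σ)
  refine hle.trans ?_
  have h2 : (d : ℝ) * D - 1 ≠ 0 := by linarith
  have h3 : (d : ℝ) * D + 1 ≠ 0 := by linarith
  have hd0 : (d : ℝ) ≠ 0 := by linarith
  rw [trace_pow_fin_two (K := ℝ) (x := (D + 1) / (d * (d * D + 1)))
    (y := (D - 1) / (d * (d * D - 1)))]
  · have hle : (D - 1) / (d * (d * D - 1)) ≤ ((D + 1) / (d * (d * D + 1)) : ℝ) := by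
      rw [div_le_div_iff₀ (by nlinarith) (by nlinarith)]
      nlinarith [mul_nonneg (mul_nonneg (by linarith : (0:ℝ) ≤ d) (by linarith : (0:ℝ) ≤ D))
        (by linarith : (0 : ℝ) ≤ d - 1)]
    have h0 : (0 : ℝ) ≤ (D - 1) / (d * (d * D - 1)) :=
      div_nonneg (by linarith) (by nlinarith)
    have := pow_le_pow_left₀ h0 hle (m + 1)
    linarith
  · simpa [domainWall] using domainWall_trace_aux hd0 h2 h3
  · simpa [domainWall] using domainWall_det_aux hd0 h2 h3

end MomentBounds

/-! ### Infinite-time averages of trigonometric polynomials -/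

section TimeAverages

lemma isTimeAverage_cexp (ω : ℝ) :
    IsTimeAverage (fun t : ℝ => Complex.exp (Complex.I * ω * t)) (if ω = 0 then 1 else 0) := by
  unfold IsTimeAverage
  by_cases hω : ω = 0
  · simp only [hω, if_true]
    refine tendsto_const_nhds.congr' ?_
    filter_upwards [eventually_gt_atTop 0] with t ht
    simp [ht.ne']
  · simp only [hω, if_false]
    have hc : Complex.I * (ω : ℂ) ≠ 0 := by simp [hω]
    simp only [integral_exp_mul_complex hc]
    have hn : ∀ s : ℝ, ‖Complex.exp (Complex.I * ω * s)‖ = 1 := fun s => by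
      have := Complex.norm_exp_ofReal_mul_I (ω * s)
      rw [← this]
      congr 2
      push_cast
      ring
    rw [tendsto_zero_iff_norm_tendsto_zero]
    refine squeeze_zero' (.of_forall fun t => norm_nonneg _)
      (g := fun t : ℝ => t⁻¹ * (2 / |ω|)) ?_
      (by simpa using tendsto_inv_atTop_zero.mul_const (2 / |ω|))
    filter_upwards [eventually_gt_atTop 0] with t ht
    rw [norm_smul, norm_div, Real.norm_of_nonneg (inv_nonneg.2 ht.le)]
    have h2 : ‖Complex.exp (Complex.I * ω * t) - Complex.exp (Complex.I * ω * (0 : ℝ))‖ ≤ 2 := by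
      refine (norm_sub_le _ _).trans ?_
      rw [hn, hn]
      norm_num
    have h3 : ‖Complex.I * (ω : ℂ)‖ = |ω| := by simp
    rw [h3]
    gcongr

lemma IsTimeAverage.const_mul {f : ℝ → ℂ} {a : ℂ} (hf : IsTimeAverage f a) (c : ℂ) :
    IsTimeAverage (fun t => c * f t) (c * a) := by
  unfold IsTimeAverage at *
  refine (Tendsto.const_mul c hf).congr fun t => ?_
  rw [intervalIntegral.integral_const_mul, Complex.real_smul, Complex.real_smul]
  ring

lemma isTimeAverage_sum {κ : Type*} {s : Finset κ} {f : κ → ℝ → ℂ} {a : κ → ℂ}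
    (hc : ∀ k ∈ s, Continuous (f k)) (hf : ∀ k ∈ s, IsTimeAverage (f k) (a k)) :
    IsTimeAverage (fun t => ∑ k ∈ s, f k t) (∑ k ∈ s, a k) := by
  unfold IsTimeAverage at *
  refine (tendsto_finsetSum s hf).congr fun t => ?_
  rw [intervalIntegral.integral_finsetSum fun k hk => (hc k hk).intervalIntegrable _ _,
    Finset.smul_sum]

variable {κ : Type*} [Fintype κ]

/-- The time average of a trigonometric polynomial is its constant term. -/
lemma isTimeAverage_trigPolynomial (x : κ → ℂ) (ω : κ → ℝ) :
    IsTimeAverage (fun t : ℝ => ∑ k, x k * Complex.exp (Complex.I * ω k * t))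
      (∑ k, x k * if ω k = 0 then 1 else 0) :=
  isTimeAverage_sum (fun k _ => by fun_prop) fun k _ => (isTimeAverage_cexp (ω k)).const_mul _

/-- Parseval's identity for trigonometric polynomials with pairwise distinct frequencies (where the
coefficient does not vanish). -/
lemma isTimeAverage_norm_sq_trigPolynomial (y : κ → ℂ) (ω : κ → ℝ)
    (hω : ∀ k l, y k ≠ 0 → y l ≠ 0 → ω k = ω l → k = l) :
    IsTimeAverage (fun t : ℝ => ‖∑ k, y k * Complex.exp (Complex.I * ω k * t)‖ ^ 2)
      (∑ k, ‖y k‖ ^ 2) := by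
  have h := isTimeAverage_trigPolynomial (fun p : κ × κ => y p.1 * star (y p.2))
    (fun p => ω p.1 - ω p.2)
  have hval : ∑ p : κ × κ, y p.1 * star (y p.2) * (if ω p.1 - ω p.2 = 0 then (1 : ℂ) else 0)
      = ((∑ k, ‖y k‖ ^ 2 : ℝ) : ℂ) := by
    rw [Fintype.sum_prod_type, Complex.ofReal_sum]
    refine Finset.sum_congr rfl fun k _ => ?_
    rw [Finset.sum_eq_single k]
    · simpa using Complex.mul_conj' (y k)
    · intro l _ hl
      by_cases hk : y k = 0
      · simp [hk]
      by_cases hl' : y l = 0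
      · simp [hl']
      rw [if_neg, mul_zero]
      intro h0
      exact hl (hω k l hk hl' (sub_eq_zero.1 h0)).symm
    · simp
  rw [hval] at h
  have hfun : ∀ t : ℝ, ∑ p : κ × κ, y p.1 * star (y p.2) *
      Complex.exp (Complex.I * ((ω p.1 - ω p.2 : ℝ) : ℂ) * t) =
      ((‖∑ k, y k * Complex.exp (Complex.I * ω k * t)‖ ^ 2 : ℝ) : ℂ) := by
    intro t
    rw [Complex.ofReal_pow, ← Complex.mul_conj', map_sum, Finset.sum_mul_sum,
      Fintype.sum_prod_type]
    refine Finset.sum_congr rfl fun k _ => Finset.sum_congr rfl fun l _ => ?_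
    rw [map_mul, ← Complex.exp_conj, mul_mul_mul_comm, ← Complex.exp_add]
    simp only [Complex.star_def, map_mul, Complex.conj_I, Complex.conj_ofReal]
    congr 2
    push_cast
    ring
  simp only [hfun] at h
  unfold IsTimeAverage at *
  have h' := (Complex.continuous_re.tendsto _).comp h
  refine (h'.congr fun t => ?_)
  simp only [Function.comp_apply, intervalIntegral.integral_ofReal]
  simp only [Complex.real_smul, ← Complex.ofReal_mul, Complex.ofReal_re, smul_eq_mul]

end TimeAverages

/-! ### Equilibration and effective dimension -/

section Equilibration

lemma exp_mulVec_of_eigenvector {ι : Type*} [Fintype ι] [DecidableEq ι] {M : Matrix ι ι ℂ}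
    {w : ι → ℂ} {c : ℂ} (h : M.mulVec w = c • w) :
    (NormedSpace.exp M).mulVec w = Complex.exp c • w := by
  let _ : NormedRing (Matrix ι ι ℂ) := Matrix.linftyOpNormedRing
  let _ : NormedAlgebra ℂ (Matrix ι ι ℂ) := Matrix.linftyOpNormedAlgebra
  have hp : ∀ n : ℕ, (M ^ n).mulVec w = c ^ n • w := by
    intro n
    induction n with
    | zero => simp
    | succ n ih => rw [pow_succ, ← Matrix.mulVec_mulVec, h, Matrix.mulVec_smul, ih, smul_smul,
        pow_succ, mul_comm]
  have h1 := NormedSpace.exp_series_hasSum_exp' (𝕂 := ℂ) M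
  have hcont : Continuous fun N : Matrix ι ι ℂ => N.mulVec w := by fun_prop
  have h2 := h1.map (Matrix.mulVec.addMonoidHomLeft w) hcont
  have h3 := (NormedSpace.exp_series_hasSum_exp' (𝕂 := ℂ) c).smul_const w
  rw [← Complex.exp_eq_exp_ℂ] at h3
  refine h2.unique (h3.congr_fun ?_)
  intro n
  simp [Matrix.mulVec.addMonoidHomLeft, Matrix.smul_mulVec, hp, smul_smul]

variable {n d : ℕ} {H : Operator n d}

lemma toEuclideanCLM_exp_apply_eigenvector (hH : H.IsHermitian) (z : ℂ) (a : Fin n → Fin d) :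
    Matrix.toEuclideanCLM (𝕜 := ℂ) (NormedSpace.exp (z • H)) (hH.eigenvectorBasis a) =
      Complex.exp (z * hH.eigenvalues a) • hH.eigenvectorBasis a := by
  have h := hH.mulVec_eigenvectorBasis a
  have h' : (z • H).mulVec (hH.eigenvectorBasis a) =
      (z * hH.eigenvalues a) • (hH.eigenvectorBasis a : (Fin n → Fin d) → ℂ) := by
    rw [Matrix.smul_mulVec, h, mul_smul]
    rfl
  have h'' := exp_mulVec_of_eigenvector h'
  ext i
  exact congrFun h'' i

/-- The expectation value at time `t`, expanded in the energy eigenbasis. -/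
lemma expectation_eq_sum (hH : H.IsHermitian) (A : Operator n d) (φ : StateSpace n d) (t : ℝ) :
    expectation H A φ t = ∑ p : (Fin n → Fin d) × (Fin n → Fin d),
      (star (inner ℂ (hH.eigenvectorBasis p.1) φ) * inner ℂ (hH.eigenvectorBasis p.2) φ *
        inner ℂ (hH.eigenvectorBasis p.1)
          (Matrix.toEuclideanCLM (𝕜 := ℂ) A (hH.eigenvectorBasis p.2))) *
      Complex.exp (Complex.I * ((hH.eigenvalues p.1 - hH.eigenvalues p.2 : ℝ) : ℂ) * t) := by
  set e := hH.eigenvectorBasis with he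
  have hexp : ∀ (z : ℂ) (χ : StateSpace n d),
      Matrix.toEuclideanCLM (𝕜 := ℂ) (NormedSpace.exp (z • H)) χ =
        ∑ a, (inner ℂ (e a) χ * Complex.exp (z * hH.eigenvalues a)) • e a := by
    intro z χ
    conv_lhs => rw [← e.sum_repr' χ]
    simp only [map_sum, map_smul, he, toEuclideanCLM_exp_apply_eigenvector, smul_smul]
  unfold expectation evolved
  rw [← neg_smul, map_mul, map_mul, mul_apply_eq_comp, mul_apply_eq_comp,
    hexp, inner_sum, hexp, Fintype.sum_prod_type]
  refine Finset.sum_congr rfl fun a _ => ?_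
  rw [map_sum, inner_sum, inner_smul_right, Finset.sum_mul, Finset.sum_mul]
  refine Finset.sum_congr rfl fun b _ => ?_
  rw [map_smul, inner_smul_right, Complex.star_def, inner_conj_symm]
  have : Complex.exp (Complex.I * ((hH.eigenvalues a - hH.eigenvalues b : ℝ) : ℂ) * t) =
      Complex.exp (Complex.I * t * hH.eigenvalues a) *
        Complex.exp (-(Complex.I * t) * hH.eigenvalues b) := by
    rw [← Complex.exp_add]
    congr 1
    push_cast
    ring
  rw [this]
  ring

/-- The fluctuation is at most `‖A‖²` times the inverse effective dimension of `φ`. With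
`c_a = ⟨e_a|φ⟩` it equals `∑_{a ≠ b} |c_a|² |c_b|² |A_ab|²`, by Parseval's identity, since the gaps
are the frequencies of the expectation value; the bound then follows from
`|c_a|² |c_b|² ≤ (|c_a|⁴ + |c_b|⁴) / 2` and the fact that rows and columns of `A` have norm at most
`‖A‖`. -/
theorem exists_isFluctuation_le (hH : H.IsHermitian) (hs : NondegenerateSpectrum hH)
    (hg : NondegenerateGaps hH) (A : Operator n d) (φ : StateSpace n d) :
    ∃ δ : ℝ, IsFluctuation H A φ δ ∧ δ ≤ ‖Matrix.toEuclideanCLM (𝕜 := ℂ) A‖ ^ 2 *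
      ∑ a, ‖inner ℂ (hH.eigenvectorBasis a) φ‖ ^ 4 := by
  set e := hH.eigenvectorBasis with he
  set L := Matrix.toEuclideanCLM (𝕜 := ℂ) A with hL
  set E := hH.eigenvalues with hE
  set x : (Fin n → Fin d) × (Fin n → Fin d) → ℂ := fun p =>
    star (inner ℂ (e p.1) φ) * inner ℂ (e p.2) φ * inner ℂ (e p.1) (L (e p.2)) with hx
  set y : (Fin n → Fin d) × (Fin n → Fin d) → ℂ := fun p => if p.1 = p.2 then 0 else x p with hy
  have hexp : expectation H A φ = fun t : ℝ => ∑ p, x p *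
      Complex.exp (Complex.I * ((E p.1 - E p.2 : ℝ) : ℂ) * t) :=
    funext (expectation_eq_sum hH A φ)
  have hzero : ∀ p : (Fin n → Fin d) × (Fin n → Fin d), E p.1 - E p.2 = 0 ↔ p.1 = p.2 := fun p =>
    ⟨fun h => hs (sub_eq_zero.1 h), fun h => by rw [h, sub_self]⟩
  refine ⟨∑ p, ‖y p‖ ^ 2, ⟨∑ p, x p * if E p.1 - E p.2 = 0 then 1 else 0, ?_, ?_⟩, ?_⟩
  · rw [hexp]
    exact isTimeAverage_trigPolynomial x fun p => E p.1 - E p.2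
  · have hsub : ∀ t, expectation H A φ t - ∑ p, x p * (if E p.1 - E p.2 = 0 then 1 else 0) =
        ∑ p, y p * Complex.exp (Complex.I * ((E p.1 - E p.2 : ℝ) : ℂ) * t) := by
      intro t
      rw [hexp, ← Finset.sum_sub_distrib]
      refine Finset.sum_congr rfl fun p _ => ?_
      by_cases h : p.1 = p.2
      · simp [hy, h]
      · simp [hy, h, (hzero p).not.2 h]
    simp only [hsub]
    refine isTimeAverage_norm_sq_trigPolynomial y (fun p => E p.1 - E p.2) ?_
    intro p r hp _ hpr
    have hne : p.1 ≠ p.2 := fun h => hp (by simp [hy, h])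
    obtain ⟨h1, h2⟩ := hg p.1 p.2 r.1 r.2 hne hpr
    exact Prod.ext h1 h2
  · have hrow : ∀ a, ∑ b, ‖inner ℂ (e a) (L (e b))‖ ^ 2 ≤ ‖L‖ ^ 2 := by
      intro a
      have : ∀ b, inner ℂ (e a) (L (e b)) = inner ℂ (ContinuousLinearMap.adjoint L (e a)) (e b) :=
        fun b => (ContinuousLinearMap.adjoint_inner_left L (e b) (e a)).symm
      simp only [this]
      rw [e.sum_sq_norm_inner_left]
      have hle := (ContinuousLinearMap.adjoint L).le_opNorm (e a)
      rw [e.norm_eq_one, mul_one, LinearIsometryEquiv.norm_map] at hle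
      exact pow_le_pow_left₀ (norm_nonneg _) hle 2
    have hcol : ∀ b, ∑ a, ‖inner ℂ (e a) (L (e b))‖ ^ 2 ≤ ‖L‖ ^ 2 := by
      intro b
      rw [e.sum_sq_norm_inner_right]
      have hle := L.le_opNorm (e b)
      rw [e.norm_eq_one, mul_one] at hle
      exact pow_le_pow_left₀ (norm_nonneg _) hle 2
    set c : (Fin n → Fin d) → ℝ := fun a => ‖inner ℂ (e a) φ‖ with hc
    calc ∑ p, ‖y p‖ ^ 2 ≤ ∑ p : (Fin n → Fin d) × (Fin n → Fin d),
          (c p.1 ^ 4 / 2 * ‖inner ℂ (e p.1) (L (e p.2))‖ ^ 2 +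
            c p.2 ^ 4 / 2 * ‖inner ℂ (e p.1) (L (e p.2))‖ ^ 2) := by
          refine Finset.sum_le_sum fun p _ => ?_
          have h1 : ‖y p‖ ≤ c p.1 * c p.2 * ‖inner ℂ (e p.1) (L (e p.2))‖ := by
            simp only [hy]
            split_ifs
            · rw [norm_zero]; positivity
            · simp only [hx, norm_mul, norm_star, hc, le_refl]
          refine (pow_le_pow_left₀ (norm_nonneg _) h1 2).trans ?_
          rw [← add_mul, mul_pow]
          refine mul_le_mul_of_nonneg_right ?_ (sq_nonneg _)
          nlinarith [sq_nonneg (c p.1 ^ 2 - c p.2 ^ 2)]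
      _ = ∑ a, c a ^ 4 / 2 * ∑ b, ‖inner ℂ (e a) (L (e b))‖ ^ 2 +
            ∑ b, c b ^ 4 / 2 * ∑ a, ‖inner ℂ (e a) (L (e b))‖ ^ 2 := by
          rw [Finset.sum_add_distrib, Fintype.sum_prod_type, Fintype.sum_prod_type_right]
          simp only [Finset.mul_sum]
      _ ≤ ∑ a, c a ^ 4 / 2 * ‖L‖ ^ 2 + ∑ b, c b ^ 4 / 2 * ‖L‖ ^ 2 := by
          gcongr with a _ b _
          · exact hrow a
          · exact hcol b
      _ = ‖L‖ ^ 2 * ∑ a, c a ^ 4 := by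
          rw [← Finset.sum_mul, ← Finset.sum_div]
          ring

end Equilibration

/-! ### Concentration -/

section Probability

variable {d D m : ℕ}

lemma alpha_eq_log (hq : 1 < d * D) :
    alpha d D = Real.log ((d * D - 1) / (D + 1) : ℝ) := by
  have hd : (d : ℝ) ≠ 0 := by
    rintro h
    have : d = 0 := by exact_mod_cast h
    simp [this] at hq
  have hD : (D : ℝ) ≠ 0 := by
    rintro h
    have : D = 0 := by exact_mod_cast h
    simp [this] at hq
  have h1 : (d : ℝ) * D + 1 ≠ 0 := by positivity
  have h2 : (D : ℝ) + 1 ≠ 0 := by positivity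
  unfold alpha
  congr 1
  field_simp
  ring

/-- If the rate is positive then it is at least `log (5/4)`; equality holds for `d = 2`, `D = 3`.
Hence a threshold for `n` can be chosen independently of `d` and `D`. -/
lemma five_fourths_le_of_one_lt (hq : 1 < d * D) (h : 1 < ((d * D - 1) / (D + 1) : ℝ)) :
    5 / 4 ≤ ((d * D - 1) / (D + 1) : ℝ) := by
  rw [one_lt_div (by positivity)] at h
  rw [div_le_div_iff₀ (by norm_num) (by positivity)]
  have h' : D + 2 < d * D := by
    have : ((D + 2 : ℕ) : ℝ) < ((d * D : ℕ) : ℝ) := by push_cast; linarith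
    exact_mod_cast this
  have hD : 1 ≤ D := Nat.pos_of_ne_zero fun h => by simp [h] at hq
  suffices hN : 5 * D + 9 ≤ 4 * (d * D) by
    have : ((5 * D + 9 : ℕ) : ℝ) ≤ ((4 * (d * D) : ℕ) : ℝ) := by exact_mod_cast hN
    push_cast at this
    linarith
  rcases Nat.lt_or_ge d 4 with hd | hd
  · interval_cases d <;> omega
  · nlinarith

/-- The squared norm concentrates around `1`. -/
lemma integral_sq_norm_sq_sub_one_le (hq : 1 < d * D) {v : EuclideanSpace ℂ (Fin d)}
    (hv : ‖v‖ = 1) :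
    ∫ U, (‖mps v U‖ ^ 2 - 1) ^ 2 ∂jointHaar d D (m + 1) ≤
      ((D + 1) / (d * D - 1) : ℝ) ^ (m + 1) := by
  have hd : 1 ≤ d := Nat.pos_of_ne_zero fun h => by simp [h] at hq
  have hD : 1 ≤ D := Nat.pos_of_ne_zero fun h => by simp [h] at hq
  have hd' : (1 : ℝ) ≤ d := by exact_mod_cast hd
  have hD' : (1 : ℝ) ≤ D := by exact_mod_cast hD
  have hq' : (1 : ℝ) < d * D := by exact_mod_cast hq
  have hc := continuous_mps (n := m + 1) (D := D) v
  have i1 : Integrable (fun U => (‖mps v U‖ ^ 2) ^ 2) (jointHaar d D (m + 1)) :=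
    integrable_of_continuous_sites (by fun_prop)
  have i2 : Integrable (fun U => 2 * ‖mps v U‖ ^ 2) (jointHaar d D (m + 1)) :=
    integrable_of_continuous_sites (by fun_prop)
  have hval : ∫ U, (‖mps v U‖ ^ 2 - 1) ^ 2 ∂jointHaar d D (m + 1) =
      (d * ((D : ℝ) ^ 2 - 1) / ((d * D : ℝ) ^ 2 - 1)) ^ (m + 1) := by
    have : ∀ U : Fin (m + 1) → SiteUnitary d D, (‖mps v U‖ ^ 2 - 1) ^ 2 =
        (‖mps v U‖ ^ 2) ^ 2 - 2 * ‖mps v U‖ ^ 2 + 1 := fun U => by ring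
    simp only [this]
    rw [integral_add (f := fun U => (‖mps v U‖ ^ 2) ^ 2 - 2 * ‖mps v U‖ ^ 2) (i1.sub i2)
      (integrable_const _), integral_sub i1 i2, integral_const_mul,
      integral_norm_sq_mps hq hv, integral_norm_pow_four_mps hq hv]
    simp
    ring
  rw [hval]
  have h1 : 0 < (d * D : ℝ) ^ 2 - 1 := by nlinarith
  refine pow_le_pow_left₀ (div_nonneg (by nlinarith) h1.le) ?_ _
  rw [div_le_div_iff₀ h1 (by linarith)]
  have : ((D : ℝ) + 1) * ((d * D) ^ 2 - 1) - d * (D ^ 2 - 1) * (d * D - 1)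
      = (D + 1) * (d * D - 1) * (d + 1) := by ring
  have h2 : 0 ≤ ((D : ℝ) + 1) * (d * D - 1) * (d + 1) :=
    mul_nonneg (mul_nonneg (by linarith) (by linarith)) (by linarith)
  linarith

lemma integral_sum_overlap_pow_four_le (hq : 1 < d * D) {v : EuclideanSpace ℂ (Fin d)}
    (hv : ‖v‖ = 1)
    (e : OrthonormalBasis (Fin (m + 1) → Fin d) ℂ (StateSpace (m + 1) d)) :
    ∫ U, ∑ a, ‖inner ℂ (e a) (mps v U)‖ ^ 4 ∂jointHaar d D (m + 1) ≤
      2 * ((D + 1) / (d * D - 1) : ℝ) ^ (m + 1) := by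
  have hd : 1 ≤ d := Nat.pos_of_ne_zero fun h => by simp [h] at hq
  have hd' : (1 : ℝ) ≤ d := by exact_mod_cast hd
  have hq' : (1 : ℝ) < d * D := by exact_mod_cast hq
  have hc := continuous_mps (n := m + 1) (D := D) v
  rw [integral_finsetSum _ fun a _ => integrable_of_continuous_sites (by fun_prop)]
  refine (Finset.sum_le_sum fun a _ =>
    integral_overlap_pow_four_le hq hv (e.norm_eq_one a)).trans ?_
  simp only [Finset.sum_const, Finset.card_univ, Fintype.card_pi, Fintype.card_fin,
    Finset.prod_const, nsmul_eq_mul]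
  push_cast
  rw [mul_left_comm, ← mul_pow]
  have h0 : (d : ℝ) * ((D + 1) / (d * (d * D + 1))) = (D + 1) / (d * D + 1) := by
    have : (d : ℝ) * D + 1 ≠ 0 := by positivity
    field_simp
  rw [h0]
  gcongr
  · linarith

/-- The vectors of squared norm at least one half that are spread over the basis `e`, in the sense
that `∑_a |⟨e_a|ψ⟩|⁴ ≤ B`. -/
def wellSpread {n : ℕ} (e : OrthonormalBasis (Fin n → Fin d) ℂ (StateSpace n d)) (B : ℝ) :
    Set (StateSpace n d) :=
  {ψ | 1 / 2 ≤ ‖ψ‖ ^ 2 ∧ ∑ a, ‖inner ℂ (e a) ψ‖ ^ 4 ≤ B}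

lemma measurableSet_wellSpread {n : ℕ}
    (e : OrthonormalBasis (Fin n → Fin d) ℂ (StateSpace n d)) (B : ℝ) :
    MeasurableSet (wellSpread e B) := by
  have h1 : IsClosed {ψ : StateSpace n d | 1 / 2 ≤ ‖ψ‖ ^ 2} :=
    isClosed_le (by fun_prop) (by fun_prop)
  have h2 : IsClosed {ψ : StateSpace n d | ∑ a, ‖inner ℂ (e a) ψ‖ ^ 4 ≤ B} :=
    isClosed_le (by fun_prop) (by fun_prop)
  exact (h1.inter h2).measurableSet

/-- Markov's inequality for the spread and Chebyshev's inequality for the norm. -/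
lemma one_sub_le_rmpsMeasure_wellSpread (hq : 1 < d * D) {v : EuclideanSpace ℂ (Fin d)}
    (hv : ‖v‖ = 1) (e : OrthonormalBasis (Fin (m + 1) → Fin d) ℂ (StateSpace (m + 1) d))
    {B : ℝ} (hB : 0 < B) :
    1 - (4 + 2 / B) * ((D + 1) / (d * D - 1) : ℝ) ^ (m + 1) ≤
      (rmpsMeasure d (m + 1) D v).real (wellSpread e B) := by
  have hc := continuous_mps (n := m + 1) (D := D) v
  rw [rmpsMeasure, map_measureReal_apply (measurable_mps v) (measurableSet_wellSpread e B)]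
  change _ ≤ (jointHaar d D (m + 1)).real _
  have hm : MeasurableSet (mps v ⁻¹' wellSpread e B : Set (Fin (m + 1) → SiteUnitary d D)) :=
    measurable_mps v (measurableSet_wellSpread e B)
  have hcompl := probReal_compl_eq_one_sub (μ := jointHaar d D (m + 1)) hm
  -- If `‖ψ‖² < 1/2`, then `‖ψ‖²` deviates from its mean `1` by more than `1/2`.
  have hsub : (mps v ⁻¹' wellSpread e B)ᶜ ⊆
      {U : Fin (m + 1) → SiteUnitary d D | 1 / 4 ≤ (‖mps v U‖ ^ 2 - 1) ^ 2} ∪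
        {U | B ≤ ∑ a, ‖inner ℂ (e a) (mps v U)‖ ^ 4} := by
    intro U hU
    by_contra hcon
    simp only [Set.mem_union, Set.mem_ofPred_eq, not_or, not_le] at hcon
    refine hU ⟨?_, hcon.2.le⟩
    nlinarith [hcon.1]
  have m1 := mul_meas_ge_le_integral_of_nonneg (μ := jointHaar d D (m + 1))
    (f := fun U => (‖mps v U‖ ^ 2 - 1) ^ 2) (ae_of_all _ fun U => sq_nonneg _)
    (integrable_of_continuous_sites (by fun_prop)) (1 / 4)
  have m2 := mul_meas_ge_le_integral_of_nonneg (μ := jointHaar d D (m + 1))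
    (f := fun U => ∑ a, ‖inner ℂ (e a) (mps v U)‖ ^ 4)
    (ae_of_all _ fun U => Finset.sum_nonneg fun _ _ => by positivity)
    (integrable_of_continuous_sites (by fun_prop)) B
  have b1 := m1.trans (integral_sq_norm_sq_sub_one_le hq hv)
  have b2 := m2.trans (integral_sum_overlap_pow_four_le hq hv e)
  have hu := (measureReal_mono (μ := jointHaar d D (m + 1)) hsub).trans (measureReal_union_le _ _)
  rw [hcompl] at hu
  generalize ((D + 1) / (d * D - 1) : ℝ) ^ (m + 1) = R at *
  rw [mul_comm, ← le_div_iff₀ hB] at b2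
  have : (4 + 2 / B) * R = 4 * R + 2 * R / B := by ring
  linarith

lemma exists_isFluctuation_normalized_le {n : ℕ} {H : Operator n d} (hH : H.IsHermitian)
    (hs : NondegenerateSpectrum hH) (hg : NondegenerateGaps hH) {A : Operator n d} {K : ℝ}
    (hA : ‖Matrix.toEuclideanCLM (𝕜 := ℂ) A‖ ≤ K) {B : ℝ} {ψ : StateSpace n d}
    (hψ : ψ ∈ wellSpread hH.eigenvectorBasis B) :
    ψ ≠ 0 ∧ ∃ δ : ℝ, IsFluctuation H A (normalized ψ) δ ∧ δ ≤ 4 * K ^ 2 * B := by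
  obtain ⟨h1, h2⟩ := hψ
  have hψ0 : ψ ≠ 0 := by
    rintro rfl
    norm_num at h1
  refine ⟨hψ0, ?_⟩
  obtain ⟨δ, hδ, hle⟩ := exists_isFluctuation_le hH hs hg A (normalized ψ)
  refine ⟨δ, hδ, hle.trans ?_⟩
  have hin : ∀ a, ‖inner ℂ (hH.eigenvectorBasis a) (normalized ψ)‖ ^ 4 =
      (‖ψ‖ ^ 2)⁻¹ ^ 2 * ‖inner ℂ (hH.eigenvectorBasis a) ψ‖ ^ 4 := by
    intro a
    rw [normalized, inner_smul_right, norm_mul, Complex.norm_real, norm_inv, norm_norm]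
    ring
  simp only [hin, ← Finset.mul_sum]
  have h3 : (‖ψ‖ ^ 2)⁻¹ ≤ 2 := by
    rw [inv_le_comm₀ (by linarith) (by norm_num)]
    linarith
  have h4 : (‖ψ‖ ^ 2)⁻¹ ^ 2 ≤ 4 := by
    have : (0 : ℝ) ≤ (‖ψ‖ ^ 2)⁻¹ := by positivity
    nlinarith
  have h5 : (0 : ℝ) ≤ ∑ a, ‖inner ℂ (hH.eigenvectorBasis a) ψ‖ ^ 4 :=
    Finset.sum_nonneg fun _ _ => by positivity
  calc _ ≤ K ^ 2 * (4 * B) := by gcongr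
    _ = 4 * K ^ 2 * B := by ring

end Probability

end RMPS

end

/-- Equilibration of random matrix product states. The constants `c₁, c₂` are absolute; the
threshold `n₀` depends only on the bound `K` on the operator norm of the observable. -/
theorem theorem1 :
    ∃ c₁ c₂ : ℝ, 0 < c₁ ∧ 0 < c₂ ∧
      ∀ K : ℝ, ∃ n₀ : ℕ, ∀ d D n : ℕ, 1 < d * D → n₀ ≤ n →
        ∀ (v : EuclideanSpace ℂ (Fin d)), ‖v‖ = 1 →
        ∀ (H : RMPS.Operator n d) (hH : H.IsHermitian),
          RMPS.NondegenerateSpectrum hH → RMPS.NondegenerateGaps hH →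
        ∀ A : RMPS.Operator n d, A.IsHermitian →
          ‖Matrix.toEuclideanCLM (𝕜 := ℂ) A‖ ≤ K →
          1 - Real.exp (-c₂ * RMPS.alpha d D * n) ≤
            (RMPS.rmpsMeasure d n D v).real
              {ψ | ψ ≠ 0 ∧ ∃ δ : ℝ, RMPS.IsFluctuation H A (RMPS.normalized ψ) δ ∧
                δ ≤ Real.exp (-c₁ * RMPS.alpha d D * n)} := by
  refine ⟨1 / 4, 1 / 4, by norm_num, by norm_num, fun K => ?_⟩
  have hlog : 0 < Real.log (5 / 4) := Real.log_pos (by norm_num)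
  obtain ⟨N, hN⟩ := exists_nat_ge (4 * max 6 (4 * K ^ 2) / Real.log (5 / 4))
  refine ⟨N + 1, fun d D n hq hn v hv H hH hs hg A _ hA => ?_⟩
  obtain ⟨m, rfl⟩ : ∃ m, n = m + 1 := ⟨n - 1, by omega⟩
  -- If the rate is not positive, then the claimed lower bound on the probability is at most `0`.
  by_cases hr : 1 < ((d * D - 1) / (D + 1) : ℝ)
  swap
  · have hα : RMPS.alpha d D ≤ 0 := by
      rw [RMPS.alpha_eq_log hq]
      have hq' : (1 : ℝ) < d * D := by exact_mod_cast hq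
      exact Real.log_nonpos (div_nonneg (by linarith) (by positivity)) (not_lt.1 hr)
    have hexp : 1 ≤ Real.exp (-(1 / 4) * RMPS.alpha d D * (m + 1 : ℕ)) := by
      refine Real.one_le_exp (mul_nonneg ?_ (Nat.cast_nonneg _))
      linarith
    exact (sub_nonpos.2 hexp).trans measureReal_nonneg
  have hr5 := RMPS.five_fourths_le_of_one_lt hq hr
  set u := Real.exp (-(1 / 4) * RMPS.alpha d D * (m + 1 : ℕ)) with hu
  have hu0 : 0 < u := Real.exp_pos _
  have hα : Real.log (5 / 4) ≤ RMPS.alpha d D := by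
    rw [RMPS.alpha_eq_log hq]
    exact Real.log_le_log (by norm_num) hr5
  have hR : ((D + 1) / (d * D - 1) : ℝ) ^ (m + 1) = u ^ 4 := by
    rw [hu, ← Real.exp_nat_mul, RMPS.alpha_eq_log hq]
    have : ((4 : ℕ) : ℝ) * (-(1 / 4) * Real.log ((d * D - 1) / (D + 1) : ℝ) * (m + 1 : ℕ)) =
        (m + 1 : ℕ) * -Real.log ((d * D - 1) / (D + 1) : ℝ) := by
      push_cast
      ring
    rw [this, Real.exp_nat_mul, Real.exp_neg, Real.exp_log (by linarith), inv_div]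
  -- The threshold on `n` makes `u` small enough to absorb the constants `6` and `4K²`.
  have hmax : max 6 (4 * K ^ 2) * u ≤ 1 := by
    have h1 : max 6 (4 * K ^ 2) ≤ 1 / 4 * RMPS.alpha d D * (m + 1 : ℕ) := by
      rw [div_le_iff₀ hlog] at hN
      have h2 : (N : ℝ) ≤ (m + 1 : ℕ) := by exact_mod_cast (by omega : N ≤ m + 1)
      have h3 : (N : ℝ) * Real.log (5 / 4) ≤ (m + 1 : ℕ) * RMPS.alpha d D :=
        mul_le_mul h2 hα hlog.le (Nat.cast_nonneg _)
      linarith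
    have h4 : u = (Real.exp (1 / 4 * RMPS.alpha d D * (m + 1 : ℕ)))⁻¹ := by
      rw [hu, ← Real.exp_neg]
      congr 1
      ring
    rw [h4, ← div_eq_mul_inv, div_le_one (Real.exp_pos _)]
    linarith [Real.add_one_le_exp (1 / 4 * RMPS.alpha d D * (m + 1 : ℕ))]
  have h6 : 6 * u ≤ 1 := (mul_le_mul_of_nonneg_right (le_max_left _ _) hu0.le).trans hmax
  have hK : 4 * K ^ 2 * u ≤ 1 := (mul_le_mul_of_nonneg_right (le_max_right _ _) hu0.le).trans hmax
  have hprob := RMPS.one_sub_le_rmpsMeasure_wellSpread hq hv hH.eigenvectorBasis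
    -- `u ^ 4 = exp (-α n)` bounds both expectations, so the level `u ^ 2` splits the rate evenly.
    (B := u ^ 2) (by positivity)
  rw [hR] at hprob
  have hfail : (4 + 2 / u ^ 2) * u ^ 4 ≤ u := by
    have : (4 + 2 / u ^ 2) * u ^ 4 = 4 * u ^ 4 + 2 * u ^ 2 := by
      field_simp
    rw [this]
    have hu2 : u ^ 4 ≤ u ^ 2 := pow_le_pow_of_le_one hu0.le (by linarith) (by norm_num)
    nlinarith
  refine (sub_le_sub_left hfail 1).trans (hprob.trans (measureReal_mono fun ψ hψ => ?_))
  obtain ⟨hψ0, δ, hδ, hle⟩ := RMPS.exists_isFluctuation_normalized_le hH hs hg hA hψ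
  refine ⟨hψ0, δ, hδ, hle.trans ?_⟩
  nlinarith
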